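/- Let $(\Omega,\mathcal F,P)$ be a probability space and let $(\mathcal F_{s,t})_{s\le t}$ ($s,t\in\mathbb R$) be a continuous factorization of it, that is, a family of sub-$\sigma$-fields of $\mathcal F$ such that (equalities of $\sigma$-fields being understood modulo null sets): (a) for all $r\le s\le t$ the $\sigma$-fields $\mathcal F_{r,s}$ and $\mathcal F_{s,t}$ are independent and together generate $\mathcal F_{r,t}$; (b) for all $s<t$ the union $\bigcup_{\varepsilon>0}\mathcal F_{s+\varepsilon,t-\varepsilon}$ (over $\varepsilon$ with $s+\varepsilon\le t-\varepsilon$) generates $\mathcal F_{s,t}$; (c) $\bigcup_{n}\mathcal F_{-n,n}$ generates $\mathcal F$. Let $\mathcal C$ be the space of all compact subsets of $\mathbb R$ (including $\emptyset$, as an isolated point) with the Borel $\sigma$-field of the Hausdorff metric. Call $E\subset\mathbb R$ elementary if it is a finite union of intervals, and let $\mathcal F_E$ be the $\sigma$-field generated by all $\mathcal F_{s,t}$ with $s<t$, $(s,t)\subset E$. For a (real or complex) $f\in L_2(\Omega,\mathcal F,P)$, the spectral measure $\mu_f$ is the finite Borel measure on $\mathcal C$ such that $$\mu_f(\{M\in\mathcal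 C: M\subset E\})=\|\mathbb E(f\mid\mathcal F_E)\|_{L_2}^2\quad\text{for all elementary } E .$$ The function $f$ is called stable if $\mu_f$ is concentrated on the set of finite $M\in\mathcal C$, i.e. $\mu_f(\{M: |M|=\infty\})=0$, and sensitive if $\mu_f$ is concentrated on the set of infinite $M\in\mathcal C$, i.e. $\mu_f(\{M:|M|<\infty\})=0$. Then there exists a sub-$\sigma$-field $\mathcal F_{\mathrm{stable}}\subset\mathcal F$ such that for all $f\in L_2(\Omega,\mathcal F,P)$: $f$ is stable if and only if $f$ is (almost everywhere equal to a function that is) $\mathcal F_{\mathrm{stable}}$-measurable; and $f$ is sensitive if and only if $\mathbb E(f\mid\mathcal F_{\mathrm{stable}})=0$ almost surely. -/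

import Mathlib

open MeasureTheory ProbabilityTheory TopologicalSpace Set

/-- The space of compact subsets of `ℝ` (the empty set included) carries the Borel σ-field of the
Vietoris topology. On nonempty compact sets this is the topology of the Hausdorff metric, and the
empty set is an isolated point. -/
instance instMeasurableSpaceCompactsReal : MeasurableSpace (Compacts ℝ) := borel (Compacts ℝ)

instance instBorelSpaceCompactsReal : BorelSpace (Compacts ℝ) := ⟨rfl⟩

/-- Two sub-σ-fields coincide modulo `P`-null sets: every set of one of them is almost surely
equal to a set of the other one. -/
def EqModNull {Ω : Type*} {m0 : MeasurableSpace Ω} (P : Measure Ω)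
    (m₁ m₂ : MeasurableSpace Ω) : Prop :=
  eventuallyMeasurableSpace m₁ (ae P) = eventuallyMeasurableSpace m₂ (ae P)

/-- A continuous factorization (over `ℝ`) of the probability space `(Ω, m0, P)`: a two-parameter
family of sub-σ-fields `F s t`, `s ≤ t` (the values for `s > t` play no role). As usual in
probability, equalities between σ-fields are understood modulo null sets. -/
structure IsContinuousFactorization {Ω : Type*} {m0 : MeasurableSpace Ω} (P : Measure Ω)
    (F : ℝ → ℝ → MeasurableSpace Ω) : Prop where
  le : ∀ s t : ℝ, s ≤ t → F s t ≤ m0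
  indep : ∀ r s t : ℝ, r ≤ s → s ≤ t → Indep (F r s) (F s t) P
  generate : ∀ r s t : ℝ, r ≤ s → s ≤ t → EqModNull P (F r s ⊔ F s t) (F r t)
  continuous : ∀ s t : ℝ, s < t →
    EqModNull P (⨆ (ε : ℝ) (_ : 0 < ε) (_ : s + ε ≤ t - ε), F (s + ε) (t - ε)) (F s t)
  exhaust : EqModNull P (⨆ n : ℕ, F (-(n : ℝ)) n) m0

/-- An elementary set: a finite union of intervals (of any kind, bounded or not). -/
def IsElementary (E : Set ℝ) : Prop :=
  ∃ S : Set (Set ℝ), S.Finite ∧ (∀ J ∈ S, J.OrdConnected) ∧ E = ⋃₀ S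

/-- The σ-field `F_E` generated by all `F s t` with `(s, t) ⊆ E`. If `E` is, up to a finite set,
the union of disjoint intervals `(s₁, t₁), …, (sₙ, tₙ)`, then this is (modulo null sets)
the σ-field generated by the independent σ-fields `F s₁ t₁, …, F sₙ tₙ`. -/
abbrev fieldOn {Ω : Type*} (F : ℝ → ℝ → MeasurableSpace Ω) (E : Set ℝ) : MeasurableSpace Ω :=
  ⨆ (s : ℝ) (t : ℝ) (_ : s < t) (_ : Ioo s t ⊆ E), F s t

/-- `μ` is the spectral measure of the square integrable random variable `f`: a finite Borel
measure on the space of compact subsets of `ℝ` such that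
`μ {M | M ⊆ E} = ‖E(f | F_E)‖²` for all elementary sets `E`. -/
structure IsSpectralMeasure {Ω 𝕜 : Type*} [RCLike 𝕜] {m0 : MeasurableSpace Ω} (P : Measure Ω)
    (F : ℝ → ℝ → MeasurableSpace Ω) (f : Ω → 𝕜) (μ : Measure (Compacts ℝ)) : Prop where
  finite : IsFiniteMeasure μ
  apply_subset : ∀ E : Set ℝ, IsElementary E →
    μ {M : Compacts ℝ | (M : Set ℝ) ⊆ E} = eLpNorm (P[f | fieldOn F E]) 2 P ^ 2

/-- `f` is stable: its spectral measure is concentrated on the finite sets. -/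
def IsStableRV {Ω 𝕜 : Type*} [RCLike 𝕜] {m0 : MeasurableSpace Ω} (P : Measure Ω)
    (F : ℝ → ℝ → MeasurableSpace Ω) (f : Ω → 𝕜) : Prop :=
  ∃ μ : Measure (Compacts ℝ), IsSpectralMeasure P F f μ ∧
    μ {M : Compacts ℝ | (M : Set ℝ).Infinite} = 0

/-- `f` is sensitive: its spectral measure is concentrated on the infinite sets. -/
def IsSensitiveRV {Ω 𝕜 : Type*} [RCLike 𝕜] {m0 : MeasurableSpace Ω} (P : Measure Ω)
    (F : ℝ → ℝ → MeasurableSpace Ω) (f : Ω → 𝕜) : Prop :=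
  ∃ μ : Measure (Compacts ℝ), IsSpectralMeasure P F f μ ∧
    μ {M : Compacts ℝ | (M : Set ℝ).Finite} = 0

/-! For elementary `E` the conditional expectations given `fieldOn F E` are commuting orthogonal
projections of real L², with product corresponding to intersection (`condExp_condExp_fieldOn`). The
indicators of `{M | M ⊆ E}` multiply in the same way. Hence linear combinations of the projections
have a functional calculus over the spectral measure (`HasSymbol`), which itself is constructed in
`exists_spectralMeasure`.

The main operator is the noise: cut `[-n, n)` into dyadic cells, keep each cell independently with
probability `ρ`, and average the conditional expectations on what is kept. Its symbol is `ρ ^ N`,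
with `N` the number of cells that `M` meets. As `n` grows the symbol tends to `ρ ^ |M|`, which is
`0` for infinite `M`, and for finite `M` it tends to `1` as `ρ → 1`. So `f` is stable exactly when
thinning with `ρ` close to `1` moves it little, uniformly in `n` (`isStableVector_iff`).

In this form stability is visibly a closed linear condition. It also passes from `f` to `|f|`: since
`|E(f | F_E)| ≤ E(|f| | F_E)`, thinning moves `|f|` no more than `f`
(`norm_condExpOn_le_norm_condExpOn_abs`). The stable vectors are therefore a closed sublattice of L²
containing the constants, and such a sublattice is the L² space of a sub-σ-field
(`exists_mem_iff_aestronglyMeasurable`). Limits of noise operators map into the stable vectors, and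
through them sensitivity becomes orthogonality to all stable vectors
(`forall_isStableVector_inner_eq_zero_iff`). Complex functions are treated by real and imaginary
parts, whose spectral measures add. -/

open Filter Topology

/-! ### Inclusions and independence of σ-fields modulo null sets. -/

section NullSets

variable {Ω : Type*} {m0 : MeasurableSpace Ω} {P : Measure Ω}

theorem eventuallyMeasurableSpace_le {a b : MeasurableSpace Ω}
    (h : a ≤ eventuallyMeasurableSpace b (ae P)) :
    eventuallyMeasurableSpace a (ae P) ≤ eventuallyMeasurableSpace b (ae P) :=
  fun _ ⟨t, ht, hst⟩ => EventuallyMeasurableSet.congr (h t ht) hst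

theorem le_eventuallyMeasurableSpace_trans {a b c : MeasurableSpace Ω}
    (h : a ≤ eventuallyMeasurableSpace b (ae P)) (h' : b ≤ eventuallyMeasurableSpace c (ae P)) :
    a ≤ eventuallyMeasurableSpace c (ae P) :=
  h.trans (eventuallyMeasurableSpace_le h')

theorem eventuallyMeasurableSpace_mono {a b : MeasurableSpace Ω} (h : a ≤ b) :
    eventuallyMeasurableSpace a (ae P) ≤ eventuallyMeasurableSpace b (ae P) :=
  eventuallyMeasurableSpace_le (h.trans le_eventuallyMeasurableSpace)

theorem indep_of_le_eventuallyMeasurableSpace {a b a' b' : MeasurableSpace Ω}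
    (h : Indep a b P) (ha : a' ≤ eventuallyMeasurableSpace a (ae P))
    (hb : b' ≤ eventuallyMeasurableSpace b (ae P)) : Indep a' b' P := by
  rw [Indep_iff] at h ⊢
  intro s t hs ht
  obtain ⟨s', hs', hss⟩ := ha s hs
  obtain ⟨t', ht', htt⟩ := hb t ht
  rw [measure_congr (hss.inter htt), measure_congr hss, measure_congr htt]
  exact h _ _ hs' ht'

/-- The π-system of intersections generating the supremum of two σ-fields. -/
theorem sup_eq_generateFrom_inter (a b : MeasurableSpace Ω) :
    a ⊔ b = MeasurableSpace.generateFrom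
      {s | ∃ x y, MeasurableSet[a] x ∧ MeasurableSet[b] y ∧ s = x ∩ y} := by
  apply le_antisymm
  · refine sup_le (fun s hs => ?_) (fun s hs => ?_)
    · exact MeasurableSpace.measurableSet_generateFrom
        ⟨s, univ, hs, MeasurableSet.univ, by simp⟩
    · exact MeasurableSpace.measurableSet_generateFrom
        ⟨univ, s, MeasurableSet.univ, hs, by simp⟩
  · refine MeasurableSpace.generateFrom_le ?_
    rintro _ ⟨x, y, hx, hy, rfl⟩
    exact MeasurableSet.inter ((le_sup_left : a ≤ a ⊔ b) _ hx) ((le_sup_right : b ≤ a ⊔ b) _ hy)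

theorem isPiSystem_inter_sets (a b : MeasurableSpace Ω) :
    IsPiSystem {s | ∃ x y, MeasurableSet[a] x ∧ MeasurableSet[b] y ∧ s = x ∩ y} := by
  rintro _ ⟨x, y, hx, hy, rfl⟩ _ ⟨x', y', hx', hy', rfl⟩ -
  exact ⟨x ∩ x', y ∩ y', hx.inter hx', hy.inter hy', by ac_rfl⟩

theorem indep_sup_left_of_indep_sup_right [IsProbabilityMeasure P] {a b c : MeasurableSpace Ω}
    (ha : a ≤ m0) (hb : b ≤ m0) (hc : c ≤ m0)
    (h : Indep a (b ⊔ c) P) (h' : Indep b c P) : Indep (a ⊔ b) c P := by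
  refine IndepSets.indep (sup_le ha hb) hc (isPiSystem_inter_sets a b)
    (@MeasurableSpace.isPiSystem_measurableSet _ c) (sup_eq_generateFrom_inter a b)
    (@MeasurableSpace.generateFrom_measurableSet _ c).symm ?_
  rw [IndepSets_iff]
  rw [Indep_iff] at h h'
  rintro _ t ⟨x, y, hx, hy, rfl⟩ ht
  have ht' : MeasurableSet[c] t := ht
  have hy2 := (le_sup_left : b ≤ b ⊔ c) _ hy
  rw [inter_assoc, h _ _ hx (hy2.inter ((le_sup_right : c ≤ b ⊔ c) _ ht')), h' _ _ hy ht',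
    h _ _ hx hy2, mul_assoc]

end NullSets

/-! ### The σ-fields of elementary sets, and independence over complementary sets. -/

section FieldOn

variable {Ω : Type*} {m0 : MeasurableSpace Ω} {P : Measure Ω} {F : ℝ → ℝ → MeasurableSpace Ω}

theorem le_fieldOn {E : Set ℝ} {s t : ℝ} (hst : s < t) (h : Ioo s t ⊆ E) : F s t ≤ fieldOn F E :=
  le_iSup_of_le s <| le_iSup_of_le t <| le_iSup_of_le hst <| le_iSup_of_le h le_rfl

theorem fieldOn_le_iff {E : Set ℝ} {m : MeasurableSpace Ω} :
    fieldOn F E ≤ m ↔ ∀ s t, s < t → Ioo s t ⊆ E → F s t ≤ m := by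
  simp only [fieldOn, iSup_le_iff]

theorem fieldOn_mono {E E' : Set ℝ} (h : E ⊆ E') : fieldOn F E ≤ fieldOn F E' :=
  fieldOn_le_iff.2 fun _ _ hlt hE => le_fieldOn hlt (hE.trans h)

namespace IsContinuousFactorization

variable (hF : IsContinuousFactorization P F)
include hF

theorem fieldOn_le (E : Set ℝ) : fieldOn F E ≤ m0 :=
  fieldOn_le_iff.2 fun s t h _ => hF.le s t h.le

theorem le_sup {r s t : ℝ} (hrs : r ≤ s) (hst : s ≤ t) :
    F r t ≤ eventuallyMeasurableSpace (F r s ⊔ F s t) (ae P) :=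
  (hF.generate r s t hrs hst).symm ▸ le_eventuallyMeasurableSpace

theorem sup_le {r s t : ℝ} (hrs : r ≤ s) (hst : s ≤ t) :
    F r s ⊔ F s t ≤ eventuallyMeasurableSpace (F r t) (ae P) :=
  (hF.generate r s t hrs hst) ▸ le_eventuallyMeasurableSpace

theorem mono {r s t u : ℝ} (hrs : r ≤ s) (hst : s ≤ t) (htu : t ≤ u) :
    F s t ≤ eventuallyMeasurableSpace (F r u) (ae P) :=
  le_eventuallyMeasurableSpace_trans (le_sup_left.trans (hF.sup_le hst htu))
    (le_sup_right.trans (hF.sup_le hrs (hst.trans htu)))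

theorem fieldOn_Ioo_le (s t : ℝ) :
    fieldOn F (Ioo s t) ≤ eventuallyMeasurableSpace (F s t) (ae P) := by
  refine fieldOn_le_iff.2 fun a b hab h => ?_
  have := (Ioo_subset_Ioo_iff hab).1 h
  exact hF.mono this.1 hab.le this.2

/-- A bound for the σ-fields of all intervals inside `G` follows from the bound for those intervals
that avoid a fixed finite set. -/
theorem le_of_disjoint_finite {G D : Set ℝ} (hD : D.Finite) {b : MeasurableSpace Ω}
    (h : ∀ s t, s < t → Ioo s t ⊆ G → Disjoint (Ioo s t) D →
      F s t ≤ eventuallyMeasurableSpace b (ae P)) :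
    ∀ s t, s < t → Ioo s t ⊆ G → F s t ≤ eventuallyMeasurableSpace b (ae P) := by
  have key : ∀ n : ℕ, ∀ s t, (D ∩ Ioo s t).ncard ≤ n → s < t → Ioo s t ⊆ G →
      F s t ≤ eventuallyMeasurableSpace b (ae P) := by
    intro n
    induction n with
    | zero =>
      intro s t hn hst hG
      refine h s t hst hG ?_
      rw [Nat.le_zero, Set.ncard_eq_zero (hD.subset inter_subset_left)] at hn
      rw [disjoint_comm]
      exact disjoint_iff_inter_eq_empty.2 hn
    | succ n ih =>
      intro s t hn hst hG
      by_cases hd : Disjoint (Ioo s t) D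
      · exact h s t hst hG hd
      · obtain ⟨c, hc, hcD⟩ := not_disjoint_iff.1 hd
        have hfin : (D ∩ Ioo s t).Finite := hD.subset inter_subset_left
        have hsub : ∀ a b, Ioo a b ⊆ Ioo s t → c ∉ Ioo a b → (D ∩ Ioo a b).ncard ≤ n := by
          intro a b hab hcab
          have : (D ∩ Ioo a b).ncard < (D ∩ Ioo s t).ncard := by
            refine Set.ncard_lt_ncard ⟨inter_subset_inter_right _ hab, fun hh => ?_⟩ hfin
            exact hcab (hh ⟨hcD, hc⟩).2
          omega
        have h1 : Ioo s c ⊆ Ioo s t := Ioo_subset_Ioo_right hc.2.le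
        have h2 : Ioo c t ⊆ Ioo s t := Ioo_subset_Ioo_left hc.1.le
        -- Cutting at `c` loses only null sets, and each half contains fewer points of `D`.
        refine le_eventuallyMeasurableSpace_trans (hF.le_sup hc.1.le hc.2.le) (_root_.sup_le ?_ ?_)
        · exact ih s c (hsub _ _ h1 (by simp)) hc.1 (h1.trans hG)
        · exact ih c t (hsub _ _ h2 (by simp)) hc.2 (h2.trans hG)
  intro s t
  exact key _ s t le_rfl

theorem fieldOn_le_of_disjoint_finite {G D : Set ℝ} (hD : D.Finite) {b : MeasurableSpace Ω}
    (h : ∀ s t, s < t → Ioo s t ⊆ G → Disjoint (Ioo s t) D →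
      F s t ≤ eventuallyMeasurableSpace b (ae P)) :
    fieldOn F G ≤ eventuallyMeasurableSpace b (ae P) :=
  fieldOn_le_iff.2 (hF.le_of_disjoint_finite hD h)

end IsContinuousFactorization

theorem subset_or_disjoint_of_disjoint_frontier {X : Type*} [TopologicalSpace X] {J E : Set X}
    (hJ : IsPreconnected J) (h : Disjoint J (frontier E)) : J ⊆ E ∨ J ⊆ Eᶜ := by
  by_contra! hc
  obtain ⟨x, hx, hx'⟩ := not_subset.1 hc.1
  obtain ⟨y, hy, hy'⟩ := not_subset.1 hc.2
  have hcov : J ⊆ interior E ∪ interior Eᶜ := fun z hz => by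
    have := disjoint_left.1 h hz
    rw [frontier_eq_closure_inter_closure, mem_inter_iff, not_and_or, ← mem_compl_iff,
      ← mem_compl_iff, ← interior_compl, ← interior_compl, compl_compl] at this
    exact this.symm
  obtain ⟨z, -, hz, hz'⟩ := hJ _ _ isOpen_interior isOpen_interior hcov
    ⟨y, hy, (hcov hy).resolve_right fun h => hy' (interior_subset h)⟩
    ⟨x, hx, (hcov hx).resolve_left fun h => hx' (interior_subset h)⟩
  exact interior_subset hz' (interior_subset hz)

theorem IsLowerSet.exists_Iio_subset_subset_Iic {L : Set ℝ} (hL : IsLowerSet L) (hne : L.Nonempty)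
    (huniv : L ≠ univ) : ∃ d, Iio d ⊆ L ∧ L ⊆ Iic d := by
  obtain ⟨x, hx⟩ := (ne_univ_iff_exists_notMem L).1 huniv
  have hbdd : BddAbove L := ⟨x, fun y hy => by
    by_contra! hxy
    exact hx (hL hxy.le hy)⟩
  refine ⟨sSup L, fun y hy => ?_, fun y hy => le_csSup hbdd hy⟩
  obtain ⟨z, hz, hyz⟩ := exists_lt_of_lt_csSup hne hy
  exact hL hyz.le hz

theorem IsLowerSet.finite_frontier {L : Set ℝ} (hL : IsLowerSet L) : (frontier L).Finite := by
  rcases L.eq_empty_or_nonempty with rfl | hne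
  · simp
  by_cases huniv : L = univ
  · simp [huniv]
  obtain ⟨d, h2, h1⟩ := hL.exists_Iio_subset_subset_Iic hne huniv
  refine (finite_singleton d).subset fun y hy => ?_
  have hy1 : y ∈ Iic d := closure_minimal h1 isClosed_Iic hy.1
  have hy2 : y ∉ Iio d := fun h => hy.2 (interior_maximal h2 isOpen_Iio h)
  exact le_antisymm hy1 (not_lt.1 hy2)

/-- The complement of an interval consists of the points to its left and those to its right. This
reduces statements about intervals to half-lines. -/
theorem Set.OrdConnected.exists_compl_eq_union {J : Set ℝ} (hJ : J.OrdConnected) :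
    ∃ L R, IsLowerSet L ∧ IsLowerSet R ∧ Jᶜ = L ∪ Rᶜ := by
  rcases J.eq_empty_or_nonempty with rfl | ⟨z, hz⟩
  · exact ⟨univ, univ, isLowerSet_univ, isLowerSet_univ, by simp⟩
  refine ⟨{x | ∀ y ∈ J, x < y}, {x | ∀ y ∈ J, y < x}ᶜ, fun a b hba h y hy => hba.trans_lt (h y hy),
    isLowerSet_compl.2 fun a b hab h y hy => (h y hy).trans_le hab, ?_⟩
  ext x
  simp only [mem_compl_iff, mem_union, mem_ofPred_eq, not_not]
  constructor
  · intro hx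
    by_contra! hc
    obtain ⟨⟨a, ha, hax⟩, ⟨b, hb, hxb⟩⟩ := hc
    exact hx (hJ.out ha hb ⟨hax, hxb⟩)
  · rintro (h | h) hx
    · exact (h x hx).false
    · exact (h x hx).false

theorem frontier_union_finite {E E' : Set ℝ} (h : (frontier E).Finite) (h' : (frontier E').Finite) :
    (frontier (E ∪ E')).Finite :=
  ((h.inter_of_left _).union (h'.inter_of_right _)).subset (frontier_union_subset E E')

theorem IsElementary.finite_frontier {E : Set ℝ} (hE : IsElementary E) : (frontier E).Finite := by
  obtain ⟨S, hS, hJ, rfl⟩ := hE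
  induction S, hS using Set.Finite.induction_on with
  | empty => simp
  | @insert J S _ _ ih =>
    rw [sUnion_insert]
    refine frontier_union_finite ?_ (ih fun J hJS => hJ J (mem_insert_of_mem _ hJS))
    obtain ⟨L, R, hL, hR, h⟩ := (hJ J (mem_insert _ _)).exists_compl_eq_union
    rw [← frontier_compl, h]
    refine frontier_union_finite hL.finite_frontier ?_
    rw [frontier_compl]
    exact hR.finite_frontier

namespace IsContinuousFactorization

variable (hF : IsContinuousFactorization P F)
include hF

theorem fieldOn_union_le {E E' : Set ℝ} (hE : (frontier E).Finite) :
    fieldOn F (E ∪ E') ≤ eventuallyMeasurableSpace (fieldOn F E ⊔ fieldOn F E') (ae P) := by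
  refine hF.fieldOn_le_of_disjoint_finite hE fun s t hst hG hd => ?_
  refine le_trans ?_ le_eventuallyMeasurableSpace
  rcases subset_or_disjoint_of_disjoint_frontier isPreconnected_Ioo hd with h | h
  · exact (le_fieldOn hst h).trans le_sup_left
  · refine (le_fieldOn hst fun x hx => ?_).trans le_sup_right
    exact (hG hx).resolve_left (h hx)

/-- Up to its endpoint `d` a proper nonempty lower set is a half-line. Both sides are increasing
limits of fields over bounded intervals ending or starting at `d`, where independence is an axiom.
-/
theorem indep_fieldOn_lower [IsProbabilityMeasure P] {L : Set ℝ} (hL : IsLowerSet L) :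
    Indep (fieldOn F L) (fieldOn F Lᶜ) P := by
  have hempty : fieldOn F ∅ = ⊥ := by
    rw [eq_bot_iff]
    refine fieldOn_le_iff.2 fun s t hst h => ?_
    have := nonempty_Ioo.2 hst
    simp_all
  rcases L.eq_empty_or_nonempty with rfl | hne
  · exact hempty ▸ indep_bot_left _
  by_cases huniv : L = univ
  · subst huniv
    rw [compl_univ, hempty]
    exact indep_bot_right _
  obtain ⟨d, h2, h1⟩ := hL.exists_Iio_subset_subset_Iic hne huniv
  let a : ℕ → MeasurableSpace Ω := fun n => fieldOn F (Ioo (d - n) d)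
  let b : ℕ → MeasurableSpace Ω := fun n => fieldOn F (Ioo d (d + n))
  have ha : Monotone a := fun i j hij => fieldOn_mono
    (Ioo_subset_Ioo_left (by have : (i : ℝ) ≤ j := by exact_mod_cast hij
                             linarith))
  have hb : Monotone b := fun i j hij => fieldOn_mono
    (Ioo_subset_Ioo_right (by have : (i : ℝ) ≤ j := by exact_mod_cast hij
                              linarith))
  have hab : ∀ i j, Indep (a i) (b j) P := fun i j => by
    have hi : d - i ≤ d := by simp
    have hj : d ≤ d + j := by simp
    exact indep_of_le_eventuallyMeasurableSpace (hF.indep (d - i) d (d + j) hi hj)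
      (hF.fieldOn_Ioo_le _ _) (hF.fieldOn_Ioo_le _ _)
  have hab' : Indep (⨆ i, a i) (⨆ j, b j) P := by
    refine (indep_iSup_of_monotone (fun j => ?_) (fun j => hF.fieldOn_le _)
      (iSup_le fun i => hF.fieldOn_le _) hb).symm
    exact (indep_iSup_of_monotone (fun i => hab i j) (fun i => hF.fieldOn_le _)
      (hF.fieldOn_le _) ha).symm
  refine indep_of_le_eventuallyMeasurableSpace hab' (le_trans ?_ le_eventuallyMeasurableSpace)
    (le_trans ?_ le_eventuallyMeasurableSpace)
  · refine fieldOn_le_iff.2 fun s t hst h => ?_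
    have htd : t ≤ d := by
      have : Ioo s t ⊆ Iic d := h.trans h1
      have := closure_minimal this isClosed_Iic
      rw [closure_Ioo hst.ne] at this
      exact this (right_mem_Icc.2 hst.le)
    obtain ⟨n, hn⟩ := exists_nat_ge (d - s)
    exact le_iSup_of_le n (le_fieldOn hst (Ioo_subset_Ioo (by linarith) htd))
  · refine fieldOn_le_iff.2 fun s t hst h => ?_
    have htd : d ≤ s := by
      have : Ioo s t ⊆ Ici d := fun y hy => by
        by_contra hc
        exact h hy (h2 (show y < d from not_le.1 hc))
      have := closure_minimal this isClosed_Ici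
      rw [closure_Ioo hst.ne] at this
      exact this (left_mem_Icc.2 hst.le)
    obtain ⟨n, hn⟩ := exists_nat_ge (t - d)
    exact le_iSup_of_le n (le_fieldOn hst (Ioo_subset_Ioo htd (by linarith)))

/-- Split `E ∪ E'` into `E` and `E' \ E`. The field of `E` is independent of everything outside `E`,
and that of `E' \ E` is independent of everything outside `E'`; the two facts combine by
associativity of independence. -/
theorem indep_fieldOn_union [IsProbabilityMeasure P] {E E' : Set ℝ}
    (hE : (frontier E).Finite) (h : Indep (fieldOn F E) (fieldOn F Eᶜ) P)
    (h' : Indep (fieldOn F E') (fieldOn F E'ᶜ) P) :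
    Indep (fieldOn F (E ∪ E')) (fieldOn F (E ∪ E')ᶜ) P := by
  have h3 : Indep (fieldOn F E ⊔ fieldOn F (E' \ E)) (fieldOn F (E ∪ E')ᶜ) P := by
    refine indep_sup_left_of_indep_sup_right (hF.fieldOn_le _) (hF.fieldOn_le _) (hF.fieldOn_le _)
      (indep_of_le_eventuallyMeasurableSpace h le_eventuallyMeasurableSpace
        ((_root_.sup_le (fieldOn_mono fun x hx => hx.2) (fieldOn_mono fun x hx => ?_)).trans
          le_eventuallyMeasurableSpace))
      (indep_of_le_eventuallyMeasurableSpace h'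
        ((fieldOn_mono fun x hx => hx.1).trans le_eventuallyMeasurableSpace)
        ((fieldOn_mono fun x hx => ?_).trans le_eventuallyMeasurableSpace))
    · exact fun hxE => hx (Or.inl hxE)
    · exact fun hxE => hx (Or.inr hxE)
  refine indep_of_le_eventuallyMeasurableSpace h3 ?_ le_eventuallyMeasurableSpace
  rw [← union_sdiff_self]
  exact hF.fieldOn_union_le hE

theorem indep_fieldOn_compl [IsProbabilityMeasure P] {E : Set ℝ} (hE : IsElementary E) :
    Indep (fieldOn F E) (fieldOn F Eᶜ) P := by
  obtain ⟨S, hS, hJ, rfl⟩ := hE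
  induction S, hS using Set.Finite.induction_on with
  | empty =>
    rw [sUnion_empty]
    exact hF.indep_fieldOn_lower isLowerSet_empty
  | @insert J S _ hS ih =>
    have hJS : ∀ J' ∈ S, J'.OrdConnected := fun J' h => hJ J' (mem_insert_of_mem _ h)
    have hJc := hJ J (mem_insert _ _)
    rw [sUnion_insert]
    refine hF.indep_fieldOn_union
      (IsElementary.finite_frontier ⟨{J}, finite_singleton J, by simpa using hJc, by simp⟩) ?_
      (ih hJS)
    obtain ⟨L, R, hL, hR, h⟩ := hJc.exists_compl_eq_union
    have hR' : Indep (fieldOn F Rᶜ) (fieldOn F Rᶜᶜ) P := by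
      rw [compl_compl]
      exact (hF.indep_fieldOn_lower hR).symm
    -- The complement of `J` is a union of two half-lines, and the claim is symmetric under
    -- complements.
    have := (hF.indep_fieldOn_union hL.finite_frontier (hF.indep_fieldOn_lower hL) hR').symm
    rwa [← h, compl_compl] at this

end IsContinuousFactorization

end FieldOn

/-! ### Conditional expectations: null sets and independent enlargements. -/

section CondExp

variable {Ω : Type*} {m0 : MeasurableSpace Ω} {P : Measure Ω} [IsProbabilityMeasure P]

theorem condExp_ae_eq_of_le_of_le_eventuallyMeasurableSpace {b c : MeasurableSpace Ω}
    (hc : c ≤ m0) (hbc : b ≤ c) (h : c ≤ eventuallyMeasurableSpace b (ae P))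
    (f : Ω → ℝ) : P[f | c] =ᵐ[P] P[f | b] := by
  by_cases hf : Integrable f P
  swap
  · rw [condExp_of_not_integrable hf, condExp_of_not_integrable hf]
  refine (ae_eq_condExp_of_forall_setIntegral_eq hc hf
    (fun s _ _ => integrable_condExp.integrableOn) (fun s hs _ => ?_)
    (stronglyMeasurable_condExp.mono hbc).aestronglyMeasurable).symm
  obtain ⟨t, ht, hst⟩ := h s hs
  rw [setIntegral_congr_set hst, setIntegral_congr_set hst,
    setIntegral_condExp (hbc.trans hc) hf ht]

/-- Since `a` is independent of `e`, which carries both `g` and `c`, integrals over `x ∩ y` factor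
as `P x` times an integral over `y`. Such sets form a π-system generating `a ⊔ c`, so `a` adds no
information. -/
theorem condExp_sup_of_indep {a c e : MeasurableSpace Ω} (ha : a ≤ m0) (he : e ≤ m0) (hce : c ≤ e)
    (h : Indep a e P) {g : Ω → ℝ} (hg : StronglyMeasurable[e] g) (hgi : Integrable g P) :
    P[g | a ⊔ c] =ᵐ[P] P[g | c] := by
  have hc := hce.trans he
  have hac : a ⊔ c ≤ m0 := sup_le ha hc
  have key : ∀ k : Ω → ℝ, StronglyMeasurable[e] k → Integrable k P → ∀ x y,
      MeasurableSet[a] x → MeasurableSet[c] y →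
      ∫ ω in x ∩ y, k ω ∂P = P.real x * ∫ ω in y, k ω ∂P := by
    intro k hk hki x y hx hy
    have h1 := condExp_indep_eq he ha (hk.indicator (hce _ hy)) h.symm
    rw [← setIntegral_indicator (hc _ hy), ← setIntegral_condExp ha (hki.indicator (hc _ hy)) hx,
      setIntegral_congr_ae (g := fun _ => ∫ ω, y.indicator k ω ∂P) (ha _ hx)
        (h1.mono fun ω hω _ => hω), setIntegral_const, integral_indicator (hc _ hy), smul_eq_mul]
  refine (ae_eq_condExp_of_forall_setIntegral_eq hac hgi
    (fun s _ _ => integrable_condExp.integrableOn) (fun s hs _ => ?_)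
    (stronglyMeasurable_condExp.mono (le_sup_right : c ≤ a ⊔ c)).aestronglyMeasurable).symm
  induction s, hs using MeasurableSpace.induction_on_inter (sup_eq_generateFrom_inter a c)
    (isPiSystem_inter_sets a c) with
  | empty => simp
  | basic s hs =>
    obtain ⟨x, y, hx, hy, rfl⟩ := hs
    rw [key g hg hgi x y hx hy, key _ (stronglyMeasurable_condExp.mono hce) integrable_condExp x y
      hx hy, setIntegral_condExp hc hgi hy]
  | compl t ht ih =>
    rw [setIntegral_compl (hac _ ht) integrable_condExp, setIntegral_compl (hac _ ht) hgi,
      ih (measure_lt_top _ _), integral_condExp hc]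
  | iUnion f hf hfm ih =>
    rw [integral_iUnion (fun n => hac _ (hfm n)) hf integrable_condExp.integrableOn,
      integral_iUnion (fun n => hac _ (hfm n)) hf hgi.integrableOn]
    exact tsum_congr fun n => ih n (measure_lt_top _ _)

end CondExp

/-! ### Elementary sets, and compact ones exhausting the complement of a finite set. -/

section Elementary

theorem IsElementary.of_ordConnected {J : Set ℝ} (hJ : J.OrdConnected) : IsElementary J :=
  ⟨{J}, finite_singleton J, by simpa using hJ, by simp⟩

theorem IsElementary.union {E E' : Set ℝ} (h : IsElementary E) (h' : IsElementary E') :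
    IsElementary (E ∪ E') := by
  obtain ⟨S, hS, hJ, rfl⟩ := h
  obtain ⟨S', hS', hJ', rfl⟩ := h'
  exact ⟨S ∪ S', hS.union hS', fun J hJS => hJS.elim (hJ J) (hJ' J), (sUnion_union S S').symm⟩

theorem IsElementary.inter {E E' : Set ℝ} (h : IsElementary E) (h' : IsElementary E') :
    IsElementary (E ∩ E') := by
  obtain ⟨S, hS, hJ, rfl⟩ := h
  obtain ⟨S', hS', hJ', rfl⟩ := h'
  refine ⟨image2 (· ∩ ·) S S', hS.image2 _ hS', ?_, ?_⟩
  · rintro _ ⟨J, hJS, J', hJS', rfl⟩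
    exact (hJ J hJS).inter (hJ' J' hJS')
  · rw [sUnion_inter_sUnion, sUnion_image2]
    ext x
    simp only [mem_iUnion, mem_inter_iff, exists_prop, Prod.exists, mem_prod]
    grind

theorem IsElementary.biInter {ι : Type*} {I : Finset ι} {E : ι → Set ℝ}
    (h : ∀ i ∈ I, IsElementary (E i)) : IsElementary (⋂ i ∈ I, E i) := by
  classical
  induction I using Finset.induction_on with
  | empty =>
    simpa using IsElementary.of_ordConnected ordConnected_univ
  | insert i I _ ih =>
    rw [Finset.set_biInter_insert]
    exact (h i (Finset.mem_insert_self _ _)).inter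
      (ih fun j hj => h j (Finset.mem_insert_of_mem hj))

theorem isElementary_univ : IsElementary univ := .of_ordConnected ordConnected_univ

theorem IsElementary.compl_of_ordConnected {J : Set ℝ} (hJ : J.OrdConnected) :
    IsElementary Jᶜ := by
  obtain ⟨L, R, hL, hR, h⟩ := hJ.exists_compl_eq_union
  rw [h]
  exact (of_ordConnected hL.ordConnected).union (of_ordConnected hR.compl.ordConnected)

/-- The points of `[-n, n]` at distance at least `1 / (n + 1)` from the set `D`. -/
def trimmedInterval (D : Set ℝ) (n : ℕ) : Set ℝ :=
  Icc (-n : ℝ) n ∩ ⋂ d ∈ D, (Ioo (d - 1 / (n + 1)) (d + 1 / (n + 1)))ᶜ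

theorem isElementary_trimmedInterval {D : Set ℝ} (hD : D.Finite) (n : ℕ) :
    IsElementary (trimmedInterval D n) := by
  refine (IsElementary.of_ordConnected ordConnected_Icc).inter ?_
  have := IsElementary.biInter (I := hD.toFinset)
    (E := fun d => (Ioo (d - 1 / (n + 1 : ℝ)) (d + 1 / (n + 1)))ᶜ)
    fun i _ => IsElementary.compl_of_ordConnected ordConnected_Ioo
  simpa using this

theorem isCompact_trimmedInterval (D : Set ℝ) (n : ℕ) : IsCompact (trimmedInterval D n) :=
  isCompact_Icc.inter_right (isClosed_biInter fun _ _ => isOpen_Ioo.isClosed_compl)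

theorem disjoint_trimmedInterval (D : Set ℝ) (n : ℕ) : Disjoint (trimmedInterval D n) D := by
  refine disjoint_left.2 fun x hx hxD => ?_
  have := mem_iInter₂.1 hx.2 x hxD
  refine this ⟨?_, ?_⟩ <;> simp <;> positivity

theorem trimmedInterval_mono (D : Set ℝ) : Monotone (trimmedInterval D) := by
  intro m n hmn
  have h1 : (m : ℝ) ≤ n := by exact_mod_cast hmn
  have h2 : 1 / ((n : ℝ) + 1) ≤ 1 / (m + 1) := by gcongr
  refine inter_subset_inter (Icc_subset_Icc (by linarith) h1) ?_
  refine iInter₂_mono fun d _ => compl_subset_compl.2 (Ioo_subset_Ioo (by linarith) (by linarith))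

theorem exists_Ioo_subset_trimmedInterval {D : Set ℝ} {s t ε : ℝ} (hε : 0 < ε)
    (h : Disjoint (Ioo s t) D) : ∃ n, Ioo (s + ε) (t - ε) ⊆ trimmedInterval D n := by
  obtain ⟨n, hn⟩ := exists_nat_ge (max (max (-s) t) (1 / ε))
  refine ⟨n, fun x hx => ⟨⟨?_, ?_⟩, mem_iInter₂.2 fun d hd hxd => ?_⟩⟩
  · have := (le_max_left _ _).trans ((le_max_left _ _).trans hn)
    linarith [hx.1]
  · have := (le_max_right (-s) t).trans ((le_max_left _ _).trans hn)
    linarith [hx.2]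
  · have h1 : 1 / ε ≤ n := (le_max_right _ _).trans hn
    have h2 : 1 / ((n : ℝ) + 1) < ε := by
      rw [div_le_iff₀ hε] at h1
      rw [div_lt_iff₀ (by positivity)]
      nlinarith
    exact disjoint_left.1 h ⟨by linarith [hx.1, hxd.2], by linarith [hx.2, hxd.1]⟩ hd

end Elementary

/-! ### Commutation and continuity of the conditional expectations. -/

namespace IsContinuousFactorization

variable {Ω : Type*} {m0 : MeasurableSpace Ω} {P : Measure Ω} {F : ℝ → ℝ → MeasurableSpace Ω}
  (hF : IsContinuousFactorization P F)
include hF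

/-- Modulo null sets the field of `E` is generated by those of `E \ E'` and `E ∩ E'`. The former is
independent of the field of `E'`, hence drops out; the tower property finishes. -/
theorem condExp_condExp_fieldOn [IsProbabilityMeasure P] {E E' : Set ℝ} (hE : IsElementary E)
    (hE' : IsElementary E') (f : Ω → ℝ) :
    P[P[f | fieldOn F E'] | fieldOn F E] =ᵐ[P] P[f | fieldOn F (E ∩ E')] := by
  have hfr := (hE.inter hE').finite_frontier
  have hind := hF.indep_fieldOn_compl hE'
  have h1 : fieldOn F (E \ E') ⊔ fieldOn F (E ∩ E') ≤ fieldOn F E :=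
    _root_.sup_le (fieldOn_mono sdiff_subset) (fieldOn_mono inter_subset_left)
  have h2 : fieldOn F E ≤
      eventuallyMeasurableSpace (fieldOn F (E \ E') ⊔ fieldOn F (E ∩ E')) (ae P) := by
    have := hF.fieldOn_union_le (E' := E \ E') hfr
    rwa [inter_union_sdiff, sup_comm] at this
  have h3 : Indep (fieldOn F (E \ E')) (fieldOn F E') P :=
    indep_of_le_eventuallyMeasurableSpace hind.symm
      ((fieldOn_mono fun x hx => hx.2).trans le_eventuallyMeasurableSpace)
      le_eventuallyMeasurableSpace
  calc P[P[f | fieldOn F E'] | fieldOn F E]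
      =ᵐ[P] P[P[f | fieldOn F E'] | fieldOn F (E \ E') ⊔ fieldOn F (E ∩ E')] :=
        condExp_ae_eq_of_le_of_le_eventuallyMeasurableSpace (hF.fieldOn_le _) h1 h2 _
    _ =ᵐ[P] P[P[f | fieldOn F E'] | fieldOn F (E ∩ E')] :=
        condExp_sup_of_indep (hF.fieldOn_le _) (hF.fieldOn_le _) (fieldOn_mono inter_subset_right)
          h3 stronglyMeasurable_condExp integrable_condExp
    _ =ᵐ[P] P[f | fieldOn F (E ∩ E')] :=
        condExp_condExp_of_le (fieldOn_mono inter_subset_right) (hF.fieldOn_le _)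

theorem le_iSup_fieldOn_trimmedInterval {D : Set ℝ} (hD : D.Finite) :
    m0 ≤ eventuallyMeasurableSpace (⨆ n, fieldOn F (trimmedInterval D n)) (ae P) := by
  set m := ⨆ n, fieldOn F (trimmedInterval D n)
  have h1 : ∀ s t, s < t → Ioo s t ⊆ univ → F s t ≤ eventuallyMeasurableSpace m (ae P) := by
    refine hF.le_of_disjoint_finite hD fun s t hst _ hd => ?_
    have h2 : F s t ≤ eventuallyMeasurableSpace
        (⨆ (ε : ℝ) (_ : 0 < ε) (_ : s + ε ≤ t - ε), F (s + ε) (t - ε)) (ae P) :=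
      (hF.continuous s t hst).symm ▸ le_eventuallyMeasurableSpace
    refine le_eventuallyMeasurableSpace_trans h2 (iSup_le fun ε => iSup_le fun hε => iSup_le
      fun hle => ?_)
    -- The interval from `s + ε` to `t - ε` may be a single point, while `fieldOn` uses only
    -- nondegenerate intervals; halving `ε` gives one.
    refine le_eventuallyMeasurableSpace_trans (hF.mono (r := s + ε / 2) (u := t - ε / 2)
      (by linarith) hle (by linarith)) ?_
    obtain ⟨n, hn⟩ := exists_Ioo_subset_trimmedInterval (half_pos hε) hd
    exact ((le_fieldOn (by linarith) hn).trans
      (le_iSup (fun n => fieldOn F (trimmedInterval D n)) n)).trans le_eventuallyMeasurableSpace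
  have h2 : m0 ≤ eventuallyMeasurableSpace (⨆ n : ℕ, F (-(n : ℝ)) n) (ae P) :=
    hF.exhaust.symm ▸ le_eventuallyMeasurableSpace
  refine le_eventuallyMeasurableSpace_trans h2 (iSup_le fun n => ?_)
  -- For `n = 0` the interval degenerates, hence the enlargement by one on each side.
  refine le_eventuallyMeasurableSpace_trans
    (hF.mono (r := -(n : ℝ) - 1) (u := n + 1) (by linarith) ?_ (by linarith))
    (h1 _ _ ?_ (subset_univ _)) <;>
  · have : (0 : ℝ) ≤ n := n.cast_nonneg
    linarith

theorem condExp_fieldOn_univ [IsProbabilityMeasure P] {f : Ω → ℝ} (hf : Integrable f P) :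
    P[f | fieldOn F univ] =ᵐ[P] f := by
  have h1 : m0 ≤ eventuallyMeasurableSpace (fieldOn F univ) (ae P) :=
    (hF.le_iSup_fieldOn_trimmedInterval finite_empty).trans
      (eventuallyMeasurableSpace_mono (iSup_le fun n => fieldOn_mono (subset_univ _)))
  refine (condExp_ae_eq_of_le_of_le_eventuallyMeasurableSpace le_rfl (hF.fieldOn_le _) h1
    f).symm.trans
    (condExp_of_aestronglyMeasurable' le_rfl hf.1 hf)

theorem tendsto_condExp_trimmedInterval [IsProbabilityMeasure P] {D : Set ℝ} (hD : D.Finite)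
    {f : Ω → ℝ} (hf : Integrable f P) :
    ∀ᵐ ω ∂P, Tendsto (fun n => (P[f | fieldOn F (trimmedInterval D n)]) ω) atTop (nhds (f ω)) := by
  let ℱ : Filtration ℕ m0 :=
    ⟨fun n => fieldOn F (trimmedInterval D n), fun i j hij =>
      fieldOn_mono (trimmedInterval_mono D hij),
      fun n => hF.fieldOn_le _⟩
  have h1 : P[f | ⨆ n, ℱ n] =ᵐ[P] f :=
    (condExp_ae_eq_of_le_of_le_eventuallyMeasurableSpace le_rfl (iSup_le fun n => hF.fieldOn_le _)
      (hF.le_iSup_fieldOn_trimmedInterval hD) f).symm.trans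
    (condExp_of_aestronglyMeasurable' le_rfl hf.1 hf)
  filter_upwards [tendsto_ae_condExp (ℱ := ℱ) (μ := P) f, h1] with ω hω h
  rw [h] at hω
  exact hω

end IsContinuousFactorization

/-! ### Abstract projections and their joint law on a product of two-point spaces. -/

/-- A multiplicative family of orthogonal projections of a Hilbert space indexed by elementary sets,
with the continuity property of the conditional expectations of a continuous factorization. -/
structure ElementaryProjections (H : Type*) [NormedAddCommGroup H] [InnerProductSpace ℝ H] where
  /-- The projection attached to a set. -/
  proj : Set ℝ → H →L[ℝ] H
  inner_proj : ∀ E x y, inner ℝ (proj E x) y = inner ℝ x (proj E y)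
  proj_proj : ∀ E E', IsElementary E → IsElementary E' → ∀ x,
    proj E (proj E' x) = proj (E ∩ E') x
  proj_univ : ∀ x, proj univ x = x
  tendsto : ∀ D : Set ℝ, D.Finite → ∀ x,
    Tendsto (fun n => proj (trimmedInterval D n) x) atTop (𝓝 x)

namespace ElementaryProjections

variable {H : Type*} [NormedAddCommGroup H] [InnerProductSpace ℝ H] (Q : ElementaryProjections H)

theorem inner_proj_proj {E E' : Set ℝ} (hE : IsElementary E) (hE' : IsElementary E') (x y : H) :
    inner ℝ (Q.proj E x) (Q.proj E' y) = inner ℝ x (Q.proj (E ∩ E') y) := by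
  rw [Q.inner_proj, Q.proj_proj E E' hE hE']

theorem norm_sq_proj {E : Set ℝ} (hE : IsElementary E) (x : H) :
    ‖Q.proj E x‖ ^ 2 = inner ℝ x (Q.proj E x) := by
  rw [← real_inner_self_eq_norm_sq, Q.inner_proj_proj hE hE, inter_self]

theorem inner_proj_proj_self {E E' : Set ℝ} (hE : IsElementary E) (hE' : IsElementary E') (x : H) :
    inner ℝ (Q.proj E x) (Q.proj E' x) = ‖Q.proj (E ∩ E') x‖ ^ 2 := by
  rw [Q.inner_proj_proj hE hE', Q.norm_sq_proj (hE.inter hE')]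

theorem norm_sq_sub_proj {E : Set ℝ} (hE : IsElementary E) (x : H) :
    ‖x - Q.proj E x‖ ^ 2 = ‖x‖ ^ 2 - ‖Q.proj E x‖ ^ 2 := by
  rw [norm_sub_sq_real, ← Q.norm_sq_proj hE]
  ring

theorem norm_proj_le {E : Set ℝ} (hE : IsElementary E) (x : H) : ‖Q.proj E x‖ ≤ ‖x‖ := by
  have := Q.norm_sq_sub_proj hE x
  exact (sq_le_sq₀ (norm_nonneg _) (norm_nonneg _)).1 (by nlinarith [sq_nonneg ‖x - Q.proj E x‖])

theorem norm_proj_inter_le {E E' : Set ℝ} (hE : IsElementary E) (hE' : IsElementary E') (x : H) :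
    ‖Q.proj (E ∩ E') x‖ ≤ ‖Q.proj E' x‖ := by
  rw [← Q.proj_proj E E' hE hE']
  exact Q.norm_proj_le hE _

theorem norm_proj_mono {E E' : Set ℝ} (hE : IsElementary E) (hE' : IsElementary E') (h : E ⊆ E')
    (x : H) : ‖Q.proj E x‖ ≤ ‖Q.proj E' x‖ := by
  simpa [inter_eq_left.2 h] using Q.norm_proj_inter_le hE hE' x

theorem measurableSet_cylinder_true {ι : Type*} (I : Finset ι) :
    MeasurableSet {ω : ι → Bool | ∀ i ∈ I, ω i = true} := by
  have : {ω : ι → Bool | ∀ i ∈ I, ω i = true} = ⋂ i ∈ I, (fun ω => ω i) ⁻¹' {true} := by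
    ext; simp
  rw [this]
  exact I.measurableSet_biInter fun i _ => measurable_pi_apply i (measurableSet_singleton _)

theorem isClopen_cylinder_true {ι : Type*} (I : Finset ι) :
    IsClopen {ω : ι → Bool | ∀ i ∈ I, ω i = true} := by
  have : {ω : ι → Bool | ∀ i ∈ I, ω i = true} = ⋂ i ∈ I, (fun ω => ω i) ⁻¹' {true} := by
    ext; simp
  rw [this]
  exact isClopen_biInter_finset fun i _ => (isClopen_discrete _).preimage (continuous_apply i)

/-- Commuting projections have a joint law. For a new index `j`, split `x` into `Q.proj (G j) x` and
its orthogonal remainder; the law of the first part gets coordinate `j` true, that of the second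
gets it false. -/
theorem exists_measure_cylinder_finset {ι : Type*} {G : ι → Set ℝ} (hG : ∀ i, IsElementary (G i))
    (J : Finset ι) (x : H) : ∃ ν : Measure (ι → Bool), ∀ I ⊆ J,
      ν {ω | ∀ i ∈ I, ω i = true} = ENNReal.ofReal (‖Q.proj (⋂ i ∈ I, G i) x‖ ^ 2) := by
  classical
  have hGI : ∀ I : Finset ι, IsElementary (⋂ i ∈ I, G i) :=
    fun I => IsElementary.biInter fun i _ => hG i
  induction J using Finset.induction_on generalizing x with
  | empty =>
    refine ⟨ENNReal.ofReal (‖x‖ ^ 2) • Measure.dirac fun _ => true, fun I hI => ?_⟩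
    obtain rfl := Finset.subset_empty.1 hI
    simp [Q.proj_univ]
  | insert j J hj ih =>
    obtain ⟨ν₁, h₁⟩ := ih (Q.proj (G j) x)
    obtain ⟨ν₂, h₂⟩ := ih (x - Q.proj (G j) x)
    have hm : ∀ b : Bool, Measurable fun ω : ι → Bool => Function.update ω j b := by
      intro b
      exact measurable_update'.comp (measurable_id.prodMk measurable_const)
    refine ⟨ν₁.map (fun ω => Function.update ω j true) +
      ν₂.map (fun ω => Function.update ω j false),
      fun I hI => ?_⟩
    rw [Measure.add_apply, Measure.map_apply (hm _) (measurableSet_cylinder_true I),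
      Measure.map_apply (hm _) (measurableSet_cylinder_true I)]
    by_cases hjI : j ∈ I
    · have e₁ : (fun ω : ι → Bool => Function.update ω j true) ⁻¹' {ω | ∀ i ∈ I, ω i = true} =
          {ω | ∀ i ∈ I.erase j, ω i = true} := by
        ext ω
        simp only [mem_preimage, mem_ofPred_eq, Finset.mem_erase]
        refine ⟨fun h i hi => ?_, fun h i hi => ?_⟩
        · simpa [Function.update_of_ne hi.1] using h i hi.2
        · by_cases hij : i = j
          · subst hij; simp
          · simpa [Function.update_of_ne hij] using h i ⟨hij, hi⟩
      have e₂ : (fun ω : ι → Bool => Function.update ω j false) ⁻¹' {ω | ∀ i ∈ I, ω i = true} =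
          ∅ := by
        ext ω
        simp only [mem_preimage, mem_ofPred_eq, mem_empty_iff_false, iff_false, not_forall]
        exact ⟨j, hjI, by simp⟩
      have e₃ : (⋂ i ∈ I.erase j, G i) ∩ G j = ⋂ i ∈ I, G i := by
        rw [inter_comm, ← Finset.set_biInter_insert, Finset.insert_erase hjI]
      have hIJ : I.erase j ⊆ J := fun i hi =>
        (Finset.mem_insert.1 (hI (Finset.mem_of_mem_erase hi))).resolve_left
          (Finset.ne_of_mem_erase hi)
      rw [e₁, e₂, measure_empty, add_zero, h₁ _ hIJ, Q.proj_proj _ _ (hGI _) (hG j), e₃]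
    · have hIJ : I ⊆ J := (Finset.subset_insert_iff_of_notMem hjI).1 hI
      have e : ∀ b, (fun ω : ι → Bool => Function.update ω j b) ⁻¹' {ω | ∀ i ∈ I, ω i = true} =
          {ω | ∀ i ∈ I, ω i = true} := by
        intro b
        ext ω
        refine forall₂_congr fun i hi => ?_
        simp only [Function.update_of_ne (ne_of_mem_of_not_mem hi hjI)]
      rw [e, e, h₁ I hIJ, h₂ I hIJ, ← ENNReal.ofReal_add (by positivity) (by positivity)]
      congr 1
      rw [map_sub, norm_sub_sq_real, Q.proj_proj _ _ (hGI _) (hG j),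
        Q.inner_proj_proj_self (hGI _) ((hGI _).inter (hG j)), ← inter_assoc, inter_self]
      ring

/-- After normalizing `x`, the laws for finite index sets are probability measures on a compact
space, so they converge along an ultrafilter. Cylinders are clopen, hence their measures pass to the
limit. -/
theorem exists_measure_cylinder {ι : Type*} [Countable ι] {G : ι → Set ℝ}
    (hG : ∀ i, IsElementary (G i)) (x : H) : ∃ ν : Measure (ι → Bool), ∀ I : Finset ι,
      ν {ω | ∀ i ∈ I, ω i = true} = ENNReal.ofReal (‖Q.proj (⋂ i ∈ I, G i) x‖ ^ 2) := by
  wlog hx : ‖x‖ = 1 generalizing x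
  · by_cases hx0 : x = 0
    · subst hx0
      exact ⟨0, fun I => by simp⟩
    · obtain ⟨ν, hν⟩ := this (‖x‖⁻¹ • x) (norm_smul_inv_norm (𝕜 := ℝ) hx0)
      refine ⟨ENNReal.ofReal (‖x‖ ^ 2) • ν, fun I => ?_⟩
      rw [Measure.smul_apply, hν, smul_eq_mul, ← ENNReal.ofReal_mul (by positivity), map_smul,
        norm_smul, norm_inv, norm_norm, mul_pow, ← mul_assoc, ← mul_pow,
        mul_inv_cancel₀ (norm_ne_zero_iff.2 hx0), one_pow, one_mul]
  choose ν hν using fun J => Q.exists_measure_cylinder_finset hG J x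
  have hprob : ∀ J, IsProbabilityMeasure (ν J) := fun J => ⟨by
    have := hν J ∅ (Finset.empty_subset _)
    simpa [Q.proj_univ, hx] using this⟩
  let ν' : Finset ι → ProbabilityMeasure (ι → Bool) := fun J => ⟨ν J, hprob J⟩
  let U : Ultrafilter (Finset ι) := Ultrafilter.of atTop
  have hU : (U : Filter (Finset ι)) ≤ atTop := Ultrafilter.of_le _
  have hlim : Tendsto ν' U (𝓝 (U.map ν').lim) := (U.map ν').le_nhds_lim
  refine ⟨((U.map ν').lim : ProbabilityMeasure (ι → Bool)), fun I => ?_⟩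
  have h1 := ProbabilityMeasure.tendsto_measure_of_null_frontier_of_tendsto' hlim
    (E := {ω | ∀ i ∈ I, ω i = true}) (by rw [(isClopen_cylinder_true I).frontier_eq]; simp)
  refine tendsto_nhds_unique h1 (tendsto_const_nhds.congr' ?_)
  filter_upwards [hU (eventually_ge_atTop I)] with J hJ
  exact (hν J I hJ).symm

end ElementaryProjections

/-! ### Measurability on the space of compact sets. -/

section Compacts

theorem IsOpen.isSigmaCompact_real {U : Set ℝ} (hU : IsOpen U) : IsSigmaCompact U := by
  have := hU.locallyCompactSpace
  exact isSigmaCompact_iff_sigmaCompactSpace.2 inferInstance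

theorem isSigmaCompact_of_finite_frontier {E : Set ℝ} (hE : (frontier E).Finite) :
    IsSigmaCompact E := by
  have h : interior E ∪ E \ interior E = E := union_sdiff_cancel interior_subset
  have h2 : (E \ interior E).Finite := hE.subset (sdiff_subset_sdiff_left subset_closure)
  have key : IsSigmaCompact (interior E ∪ E \ interior E) := by
    rw [union_eq_iUnion]
    exact isSigmaCompact_iUnion _
      (Bool.forall_bool.2 ⟨h2.isCompact.isSigmaCompact, isOpen_interior.isSigmaCompact_real⟩)
  rwa [h] at key

theorem measurableSet_disjoint_compacts {C : Set ℝ} (hC : IsSigmaCompact C) :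
    MeasurableSet {M : Compacts ℝ | Disjoint (M : Set ℝ) C} := by
  obtain ⟨K, hK, rfl⟩ := hC
  simp only [disjoint_iUnion_right, ofPred_forall]
  exact MeasurableSet.iInter fun n => (Compacts.isOpen_subsets_of_isOpen
    (hK n).isClosed.isOpen_compl).measurableSet.congr
      (by ext M; exact subset_compl_iff_disjoint_right)

theorem measurableSet_subset_compacts {E : Set ℝ} (hE : (frontier E).Finite) :
    MeasurableSet {M : Compacts ℝ | (M : Set ℝ) ⊆ E} := by
  have := measurableSet_disjoint_compacts
    (isSigmaCompact_of_finite_frontier (E := Eᶜ) (by rwa [frontier_compl]))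
  simpa only [disjoint_compl_right_iff_subset] using this

/-- The Vietoris topology has the subbasis of conditions `M ⊆ U` and `M ∩ V ≠ ∅` with `U`, `V` open.
The first says that `M` misses the closed set `Uᶜ`, the second denies that `M` misses `V`; both `Uᶜ`
and `V` are σ-compact. -/
theorem measurable_compacts {X : Type*} [MeasurableSpace X] {M : X → Compacts ℝ}
    (h : ∀ C : Set ℝ, IsSigmaCompact C → MeasurableSet {x | Disjoint (M x : Set ℝ) C}) :
    Measurable M := by
  have hb := borel_eq_generateFrom_of_subbasis (α := Compacts ℝ)
    (s := preimage (↑) '' (powerset '' {U : Set ℝ | IsOpen U} ∪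
      (fun V => {s | (s ∩ V).Nonempty}) '' {V : Set ℝ | IsOpen V}))
    (induced_generateFrom_eq)
  have : instMeasurableSpaceCompactsReal = borel (Compacts ℝ) := rfl
  rw [this, hb]
  refine measurable_generateFrom ?_
  rintro _ ⟨_, ⟨U, hU, rfl⟩ | ⟨V, hV, rfl⟩, rfl⟩
  · have := h Uᶜ (isSigmaCompact_univ.of_isClosed_subset (IsOpen.isClosed_compl hU) (subset_univ _))
    simp only [disjoint_compl_right_iff_subset] at this
    exact this
  · have := (h V (IsOpen.isSigmaCompact_real hV)).compl
    simp only [compl_ofPred, not_disjoint_iff_nonempty_inter] at this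
    exact this

end Compacts

section Cover

/-- Closed intervals are kept inside `V` because missing a compact set is decided by finitely many
test sets. -/
theorem exists_finset_rat_cover {K V : Set ℝ} (hK : IsCompact K) (hV : IsOpen V) (hKV : K ⊆ V) :
    ∃ t : Finset (ℚ × ℚ), (∀ p ∈ t, Icc (p.1 : ℝ) p.2 ⊆ V) ∧
      K ⊆ ⋃ p ∈ t, Ioo (p.1 : ℝ) p.2 := by
  obtain ⟨t, ht⟩ := hK.elim_finite_subcover
    (fun p : {p : ℚ × ℚ // Icc (p.1 : ℝ) p.2 ⊆ V} => Ioo (p.1.1 : ℝ) p.1.2)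
    (fun _ => isOpen_Ioo) (fun x hx => by
      obtain ⟨ε, hε, hb⟩ := Metric.isOpen_iff.1 hV x (hKV hx)
      obtain ⟨a, ha, hax⟩ := exists_rat_btwn (sub_lt_self x hε)
      obtain ⟨b, hxb, hb'⟩ := exists_rat_btwn (lt_add_of_pos_right x hε)
      refine mem_iUnion.2 ⟨⟨(a, b), fun y hy => hb ?_⟩, hax, hxb⟩
      rw [Real.ball_eq_Ioo]
      exact ⟨ha.trans_le hy.1, hy.2.trans_lt hb'⟩)
  refine ⟨t.map (Function.Embedding.subtype _), ?_, ?_⟩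
  · intro p hp
    obtain ⟨q, -, rfl⟩ := Finset.mem_map.1 hp
    exact q.2
  · intro x hx
    obtain ⟨p, hp, hxp⟩ := mem_iUnion₂.1 (ht hx)
    exact mem_iUnion₂.2 ⟨p.1, Finset.mem_map_of_mem _ hp, hxp⟩

/-- Away from its frontier a set agrees with its closure and with its interior, so trimming makes it
compact. -/
theorem isCompact_inter_trimmedInterval_frontier (E : Set ℝ) (n : ℕ) :
    IsCompact (E ∩ trimmedInterval (frontier E) n) := by
  have : E ∩ trimmedInterval (frontier E) n = closure E ∩ trimmedInterval (frontier E) n := by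
    refine Subset.antisymm (inter_subset_inter_left _ subset_closure) fun x hx => ⟨?_, hx.2⟩
    by_contra h
    refine disjoint_left.1 (disjoint_trimmedInterval (frontier E) n) hx.2 ⟨hx.1, fun h' => ?_⟩
    exact h (interior_subset h')
  rw [this]
  exact (isCompact_trimmedInterval _ n).inter_left isClosed_closure

theorem inter_trimmedInterval_frontier_subset_interior (E : Set ℝ) (n : ℕ) :
    E ∩ trimmedInterval (frontier E) n ⊆ interior E := by
  intro x hx
  by_contra h
  exact disjoint_left.1 (disjoint_trimmedInterval (frontier E) n) hx.2 ⟨subset_closure hx.1, h⟩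

end Cover

/-! ### The random compact set encoded by the test sets it misses. -/

section RandomCompact

/-- A countable family of open sets: the rational intervals and the complements of `[-n, n]`. -/
def testSet : (ℚ × ℚ) ⊕ ℕ → Set ℝ :=
  Sum.elim (fun p => Ioo (p.1 : ℝ) p.2) fun n => (Icc (-n : ℝ) n)ᶜ

theorem isOpen_testSet (i : (ℚ × ℚ) ⊕ ℕ) : IsOpen (testSet i) := by
  rcases i with p | n
  · exact isOpen_Ioo
  · exact isClosed_Icc.isOpen_compl

theorem isElementary_compl_testSet (i : (ℚ × ℚ) ⊕ ℕ) : IsElementary (testSet i)ᶜ := by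
  rcases i with p | n
  · exact .compl_of_ordConnected ordConnected_Ioo
  · change IsElementary (Icc (-n : ℝ) n)ᶜᶜ
    rw [compl_compl]
    exact .of_ordConnected ordConnected_Icc

/-- The closed set avoiding all test sets selected by `ω`. -/
def avoidingSet (ω : (ℚ × ℚ) ⊕ ℕ → Bool) : Set ℝ :=
  (⋃ i, ⋃ (_ : ω i = true), testSet i)ᶜ

theorem isClosed_avoidingSet (ω : (ℚ × ℚ) ⊕ ℕ → Bool) : IsClosed (avoidingSet ω) :=
  (isOpen_iUnion fun i => isOpen_iUnion fun _ => isOpen_testSet i).isClosed_compl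

theorem isCompact_avoidingSet {ω : (ℚ × ℚ) ⊕ ℕ → Bool} (h : ∃ n, ω (Sum.inr n) = true) :
    IsCompact (avoidingSet ω) := by
  obtain ⟨n, hn⟩ := h
  refine (isCompact_Icc (a := (-n : ℝ)) (b := n)).of_isClosed_subset (isClosed_avoidingSet ω) ?_
  intro x hx
  by_contra h
  exact hx (mem_iUnion₂.2 ⟨Sum.inr n, hn, h⟩)

/-- By compactness finitely many selected test sets cover `K`. The right side is a countable union
of cylinders, which yields measurability. -/
theorem disjoint_avoidingSet_iff {ω : (ℚ × ℚ) ⊕ ℕ → Bool} {K : Set ℝ} (hK : IsCompact K) :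
    Disjoint (avoidingSet ω) K ↔
      ∃ I : Finset ((ℚ × ℚ) ⊕ ℕ), K ⊆ ⋃ i ∈ I, testSet i ∧ ∀ i ∈ I, ω i = true := by
  rw [disjoint_comm, avoidingSet, disjoint_compl_right_iff_subset]
  constructor
  · intro h
    have h' : K ⊆ ⋃ i : {i // ω i = true}, testSet i := by
      rwa [iUnion_subtype]
    obtain ⟨t, ht⟩ := hK.elim_finite_subcover _ (fun i : {i // ω i = true} => isOpen_testSet i.1) h'
    refine ⟨t.map (Function.Embedding.subtype _), fun x hx => ?_, fun i hi => ?_⟩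
    · obtain ⟨p, hp, hxp⟩ := mem_iUnion₂.1 (ht hx)
      exact mem_iUnion₂.2 ⟨p.1, Finset.mem_map_of_mem _ hp, hxp⟩
    · obtain ⟨q, -, rfl⟩ := Finset.mem_map.1 hi
      exact q.2
  · rintro ⟨I, hI, hω⟩ x hx
    obtain ⟨i, hi, hxi⟩ := mem_iUnion₂.1 (hI hx)
    exact mem_iUnion₂.2 ⟨i, hω i hi, hxi⟩

open Classical in
/-- The compact set avoiding all test sets selected by `ω`, when it is bounded. -/
noncomputable def avoidingCompact (ω : (ℚ × ℚ) ⊕ ℕ → Bool) : Compacts ℝ :=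
  if h : ∃ n, ω (Sum.inr n) = true then ⟨avoidingSet ω, isCompact_avoidingSet h⟩ else ⊥

theorem coe_avoidingCompact {ω : (ℚ × ℚ) ⊕ ℕ → Bool} (h : ∃ n, ω (Sum.inr n) = true) :
    (avoidingCompact ω : Set ℝ) = avoidingSet ω := by
  rw [avoidingCompact, dif_pos h]
  rfl

theorem avoidingCompact_subset (ω : (ℚ × ℚ) ⊕ ℕ → Bool) :
    (avoidingCompact ω : Set ℝ) ⊆ avoidingSet ω := by
  by_cases h : ∃ n, ω (Sum.inr n) = true
  · rw [coe_avoidingCompact h]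
  · rw [avoidingCompact, dif_neg h]
    simp

theorem measurable_avoidingCompact : Measurable avoidingCompact := by
  refine measurable_compacts fun C hC => ?_
  obtain ⟨K, hK, rfl⟩ := hC
  have hgood : MeasurableSet {ω : (ℚ × ℚ) ⊕ ℕ → Bool | ∃ n, ω (Sum.inr n) = true} := by
    rw [ofPred_exists]
    exact MeasurableSet.iUnion fun n => measurable_pi_apply (Sum.inr n) (measurableSet_singleton _)
  have hdisj : ∀ n, MeasurableSet {ω | Disjoint (avoidingSet ω) (K n)} := by
    intro n
    simp only [disjoint_avoidingSet_iff (hK n), ofPred_exists, ofPred_and]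
    exact MeasurableSet.iUnion fun I => (MeasurableSet.const _).inter
      (ElementaryProjections.measurableSet_cylinder_true I)
  have : {ω | Disjoint (avoidingCompact ω : Set ℝ) (⋃ n, K n)} =
      {ω | ∃ n, ω (Sum.inr n) = true}ᶜ ∪ ⋂ n, {ω | Disjoint (avoidingSet ω) (K n)} := by
    ext ω
    simp only [mem_ofPred_eq, mem_union, mem_compl_iff, mem_iInter]
    by_cases h : ∃ n, ω (Sum.inr n) = true
    · simp [coe_avoidingCompact h, h]
    · simp only [h, not_false_eq_true, true_or, iff_true]
      rw [avoidingCompact, dif_neg h]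
      simp
  rw [this]
  exact hgood.compl.union (MeasurableSet.iInter hdisj)

end RandomCompact

/-! ### Existence of spectral measures. -/

namespace ElementaryProjections

variable {H : Type*} [NormedAddCommGroup H] [InnerProductSpace ℝ H] (Q : ElementaryProjections H)

/-- Take the joint law `ν` of the projections on complements of test sets; coordinate `i` being true
means that the random set misses `testSet i`. The spectral measure is the law of `avoidingCompact`.
General `E` is reached by finite rational covers away from its frontier. -/
theorem exists_spectralMeasure (x : H) : ∃ μ : Measure (Compacts ℝ), IsFiniteMeasure μ ∧
    ∀ E, IsElementary E → μ {M | (M : Set ℝ) ⊆ E} = ENNReal.ofReal (‖Q.proj E x‖ ^ 2) := by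
  classical
  obtain ⟨ν, hν⟩ := Q.exists_measure_cylinder isElementary_compl_testSet x
  have huniv : ν univ = ENNReal.ofReal (‖x‖ ^ 2) := by
    have := hν ∅
    simpa [Q.proj_univ] using this
  have hfin : IsFiniteMeasure ν := ⟨by rw [huniv]; exact ENNReal.ofReal_lt_top⟩
  have hGI : ∀ I : Finset ((ℚ × ℚ) ⊕ ℕ), IsElementary (⋂ i ∈ I, (testSet i)ᶜ) :=
    fun I => IsElementary.biInter fun i _ => isElementary_compl_testSet i
  -- The event of lying in `[-n, n]` has mass at least the squared norm of a projection tending to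
  -- `x`, so the default value in `avoidingCompact` has no mass.
  have hbdd : ∀ᵐ ω ∂ν, ∃ n, ω (Sum.inr n) = true := by
    have hm : MeasurableSet {ω : (ℚ × ℚ) ⊕ ℕ → Bool | ∃ n, ω (Sum.inr n) = true} := by
      rw [ofPred_exists]
      exact MeasurableSet.iUnion fun n =>
        measurable_pi_apply (Sum.inr n) (measurableSet_singleton _)
    refine (ae_iff_measure_eq hm.nullMeasurableSet).2
      (le_antisymm (measure_mono (subset_univ _)) ?_)
    have hlim := ((Q.tendsto ∅ finite_empty x).norm.pow 2)
    rw [huniv]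
    refine le_of_tendsto (ENNReal.tendsto_ofReal hlim) (Eventually.of_forall fun n => ?_)
    have hle : ‖Q.proj (trimmedInterval ∅ n) x‖ ≤ ‖Q.proj (testSet (Sum.inr n))ᶜ x‖ :=
      Q.norm_proj_mono (isElementary_trimmedInterval finite_empty n)
          (isElementary_compl_testSet (Sum.inr n))
        (fun y hy (hy' : y ∉ Icc (-n : ℝ) n) => hy' hy.1) x
    have h1 := hν {Sum.inr n}
    simp only [Finset.mem_singleton, forall_eq, iInter_iInter_eq_left] at h1
    refine le_trans ?_ (h1.symm.le.trans (measure_mono fun ω hω => ⟨n, hω⟩))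
    exact ENNReal.ofReal_le_ofReal (by gcongr)
  -- If `testSet j` is covered by the sets of `I`, missing it as well does not change the
  -- intersection of complements, so both cylinders have the same mass.
  have hcons : ∀ᵐ ω ∂ν, ∀ I : Finset ((ℚ × ℚ) ⊕ ℕ), ∀ j, testSet j ⊆ ⋃ i ∈ I, testSet i →
      (∀ i ∈ I, ω i = true) → ω j = true := by
    rw [ae_all_iff]; intro I
    rw [ae_all_iff]; intro j
    rw [eventually_imp_distrib_left]
    intro hj
    have h1 : ν {ω | ∀ i ∈ insert j I, ω i = true} = ν {ω | ∀ i ∈ I, ω i = true} := by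
      rw [hν, hν, Finset.set_biInter_insert, inter_eq_right.2]
      rw [← compl_iUnion₂]
      exact compl_subset_compl.2 hj
    have h2 := ae_eq_of_subset_of_measure_ge
      (s := {ω : (ℚ × ℚ) ⊕ ℕ → Bool | ∀ i ∈ insert j I, ω i = true})
      (t := {ω | ∀ i ∈ I, ω i = true}) (fun ω hω i hi => hω i (Finset.mem_insert_of_mem hi))
      h1.symm.le (measurableSet_cylinder_true _).nullMeasurableSet (measure_ne_top _ _)
    filter_upwards [h2.mem_iff] with ω hω hI
    exact hω.2 hI j (Finset.mem_insert_self _ _)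
  refine ⟨ν.map avoidingCompact, inferInstance, fun E hE => ?_⟩
  have hfr := hE.finite_frontier
  rw [Measure.map_apply measurable_avoidingCompact (measurableSet_subset_compacts hfr)]
  have hT : ∀ n, IsElementary (trimmedInterval (frontier E) n) := isElementary_trimmedInterval hfr
  have hlimT := Q.tendsto _ hfr x
  apply le_antisymm
  · have hlim : Tendsto (fun n => ENNReal.ofReal ((‖Q.proj E x‖ +
        ‖x - Q.proj (trimmedInterval (frontier E) n) x‖) ^ 2)) atTop
        (𝓝 (ENNReal.ofReal (‖Q.proj E x‖ ^ 2))) := by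
      refine ENNReal.tendsto_ofReal (Tendsto.pow ?_ 2)
      have := (hlimT.const_sub x).norm.const_add ‖Q.proj E x‖
      simpa using this
    refine ge_of_tendsto hlim (Eventually.of_forall fun n => ?_)
    -- Upper bound: a random set inside `E` misses a finite cover of the trimmed complement of `E`.
    -- The set `R` left by this cover lies in `E` within the trimmed interval; the rest costs `‖x -
    -- Q.proj (trimmedInterval (frontier E) n) x‖`.
    have hK := isCompact_inter_trimmedInterval_frontier Eᶜ n
    have hKV := inter_trimmedInterval_frontier_subset_interior Eᶜ n
    rw [frontier_compl] at hK hKV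
    obtain ⟨t, ht, htc⟩ := exists_finset_rat_cover hK isOpen_interior hKV
    have hsub : avoidingCompact ⁻¹' {M | (M : Set ℝ) ⊆ E} ≤ᵐ[ν]
        {ω | ∀ i ∈ t.map Function.Embedding.inl, ω i = true} := by
      filter_upwards [hbdd, hcons] with ω h1 h2 hω i hi
      obtain ⟨p, hp, rfl⟩ := Finset.mem_map.1 hi
      have hd : Disjoint (avoidingSet ω) (Icc (p.1 : ℝ) p.2) := by
        rw [← coe_avoidingCompact h1]
        exact disjoint_left.2 fun y hy hy' => interior_subset (ht p hp hy') (hω hy)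
      obtain ⟨I, hI, hI'⟩ := (disjoint_avoidingSet_iff isCompact_Icc).1 hd
      exact h2 I _ (Ioo_subset_Icc_self.trans hI) hI'
    refine (measure_mono_ae hsub).trans ?_
    rw [hν]
    refine ENNReal.ofReal_le_ofReal ?_
    gcongr
    set R := ⋂ i ∈ t.map Function.Embedding.inl, (testSet i)ᶜ
    have hRT : R ∩ trimmedInterval (frontier E) n ⊆ E := by
      rintro y ⟨hyR, hyT⟩
      by_contra hyE
      obtain ⟨p, hp, hyp⟩ := mem_iUnion₂.1 (htc ⟨hyE, hyT⟩)
      exact mem_iInter₂.1 hyR (Sum.inl p) (Finset.mem_map_of_mem _ hp) hyp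
    calc ‖Q.proj R x‖ = ‖Q.proj R (Q.proj (trimmedInterval (frontier E) n) x) +
          Q.proj R (x - Q.proj (trimmedInterval (frontier E) n) x)‖ := by
            rw [← map_add, add_sub_cancel]
      _ ≤ ‖Q.proj R (Q.proj (trimmedInterval (frontier E) n) x)‖ +
          ‖Q.proj R (x - Q.proj (trimmedInterval (frontier E) n) x)‖ := norm_add_le _ _
      _ ≤ ‖Q.proj E x‖ + ‖x - Q.proj (trimmedInterval (frontier E) n) x‖ := by
        rw [Q.proj_proj _ _ (hGI _) (hT n)]
        exact add_le_add (Q.norm_proj_mono ((hGI _).inter (hT n)) hE hRT x)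
          (Q.norm_proj_le (hGI _) _)
  · have hlim : Tendsto (fun n => ENNReal.ofReal
        (‖Q.proj (E ∩ trimmedInterval (frontier E) n) x‖ ^ 2)) atTop
        (𝓝 (ENNReal.ofReal (‖Q.proj E x‖ ^ 2))) := by
      simp_rw [← fun n => Q.proj_proj _ _ hE (hT n) x]
      exact ENNReal.tendsto_ofReal ((((Q.proj E).continuous.tendsto _).comp hlimT).norm.pow 2)
    refine le_of_tendsto hlim (Eventually.of_forall fun n => ?_)
    -- Lower bound: cover the part of `[-n, n]` outside `interior E` by intervals that miss the
    -- trimmed `E`. A set missing these and the exterior of `[-n, n]` lies in `E`.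
    have hC := isCompact_inter_trimmedInterval_frontier E n
    have hCV := inter_trimmedInterval_frontier_subset_interior E n
    obtain ⟨t, ht, htc⟩ := exists_finset_rat_cover (K := Icc (-n : ℝ) n \ interior E)
      (isCompact_Icc.diff isOpen_interior) hC.isClosed.isOpen_compl
      (fun y hy hy' => hy.2 (hCV hy'))
    let I : Finset ((ℚ × ℚ) ⊕ ℕ) := insert (Sum.inr n) (t.map Function.Embedding.inl)
    have hsub : {ω | ∀ i ∈ I, ω i = true} ⊆ avoidingCompact ⁻¹' {M | (M : Set ℝ) ⊆ E} := by
      intro ω hω y hy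
      have hy' := avoidingCompact_subset ω hy
      by_contra hyE
      refine hy' (mem_iUnion₂.2 ?_)
      by_cases hyn : y ∈ Icc (-n : ℝ) n
      · obtain ⟨p, hp, hyp⟩ := mem_iUnion₂.1 (htc ⟨hyn, fun h => hyE (interior_subset h)⟩)
        exact ⟨Sum.inl p, hω _ (Finset.mem_insert_of_mem (Finset.mem_map_of_mem _ hp)), hyp⟩
      · exact ⟨Sum.inr n, hω _ (Finset.mem_insert_self _ _), hyn⟩
    refine le_trans ?_ (measure_mono hsub)
    rw [hν]
    refine ENNReal.ofReal_le_ofReal ?_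
    gcongr
    refine Q.norm_proj_mono (hE.inter (hT n)) (hGI _) (fun y hy => mem_iInter₂.2 fun i hi => ?_) x
    rcases Finset.mem_insert.1 hi with rfl | hi
    · exact not_not.2 hy.2.1
    · obtain ⟨p, hp, rfl⟩ := Finset.mem_map.1 hi
      exact fun hyp => ht p hp (Ioo_subset_Icc_self hyp) hy

end ElementaryProjections

/-! ### Counting points by dyadic cells, and random selection of cells. -/

section DyadicCells

/-- The dyadic cell `[k / 2 ^ n, (k + 1) / 2 ^ n)`. -/
def dyadicCell (n : ℕ) (k : ℤ) : Set ℝ := {x | ⌊2 ^ n * x⌋ = k}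

theorem ordConnected_dyadicCell (n : ℕ) (k : ℤ) : (dyadicCell n k).OrdConnected := by
  refine ⟨fun x hx y hy z hz => ?_⟩
  simp only [dyadicCell, mem_ofPred_eq] at hx hy ⊢
  refine le_antisymm (hy ▸ Int.floor_le_floor ?_) (hx ▸ Int.floor_le_floor ?_)
  · exact mul_le_mul_of_nonneg_left hz.2 (by positivity)
  · exact mul_le_mul_of_nonneg_left hz.1 (by positivity)

/-- The labels of the dyadic cells of level `n` inside `[-n, n)`. -/
noncomputable def dyadicLabels (n : ℕ) : Finset ℤ := Finset.Ico (-(n * 2 ^ n : ℤ)) (n * 2 ^ n)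

open Classical in
/-- The labels of the dyadic cells of level `n` inside `[-n, n)` that meet `M`. -/
noncomputable def hitLabels (n : ℕ) (M : Set ℝ) : Finset ℤ :=
  (dyadicLabels n).filter fun k => ¬ Disjoint M (dyadicCell n k)

/-- The complement of the dyadic cells of level `n` inside `[-n, n)` with labels outside `S`. -/
def allowedSet (n : ℕ) (S : Finset ℤ) : Set ℝ := ⋂ k ∈ dyadicLabels n \ S, (dyadicCell n k)ᶜ

theorem isElementary_allowedSet (n : ℕ) (S : Finset ℤ) : IsElementary (allowedSet n S) :=
  IsElementary.biInter fun k _ => .compl_of_ordConnected (ordConnected_dyadicCell n k)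

theorem subset_allowedSet_iff {n : ℕ} {S : Finset ℤ} {M : Set ℝ} :
    M ⊆ allowedSet n S ↔ hitLabels n M ⊆ S := by
  classical
  simp only [allowedSet, subset_iInter_iff, Finset.mem_sdiff, subset_compl_iff_disjoint_right,
    hitLabels, Finset.subset_iff, Finset.mem_filter]
  exact forall_congr' fun k => by tauto

theorem card_hitLabels_le {n : ℕ} {M : Set ℝ} (hM : M.Finite) :
    (hitLabels n M).card ≤ M.ncard := by
  classical
  rw [ncard_eq_toFinset_card M hM]
  refine (Finset.card_le_card fun k hk => ?_).trans
    (Finset.card_image_le (s := hM.toFinset) (f := fun x : ℝ => ⌊2 ^ n * x⌋))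
  obtain ⟨x, hxM, hx⟩ := not_disjoint_iff.1 (Finset.mem_filter.1 hk).2
  exact Finset.mem_image.2 ⟨x, hM.mem_toFinset.2 hxM, hx⟩

theorem eventually_floor_mem_dyadicLabels (x : ℝ) :
    ∀ᶠ n : ℕ in atTop, ⌊2 ^ n * x⌋ ∈ dyadicLabels n := by
  obtain ⟨m, hm⟩ := exists_nat_gt |x|
  filter_upwards [eventually_ge_atTop m] with n hn
  have hn' : |x| < n := hm.trans_le (by exact_mod_cast hn)
  obtain ⟨h1, h2⟩ := abs_lt.1 hn'
  have h3 : (0 : ℝ) < 2 ^ n := by positivity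
  refine Finset.mem_Ico.2 ⟨Int.le_floor.2 ?_, Int.floor_lt.2 ?_⟩
  · push_cast
    nlinarith
  · push_cast
    nlinarith

theorem eventually_floor_ne {x y : ℝ} (hxy : x ≠ y) :
    ∀ᶠ n : ℕ in atTop, ⌊2 ^ n * x⌋ ≠ ⌊2 ^ n * y⌋ := by
  have h0 : 0 < |x - y| := abs_pos.2 (sub_ne_zero.2 hxy)
  have h1 : Tendsto (fun n : ℕ => (2 : ℝ) ^ n * |x - y|) atTop atTop :=
    (tendsto_pow_atTop_atTop_of_one_lt one_lt_two).atTop_mul_const h0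
  filter_upwards [h1.eventually_ge_atTop 1] with n hn h
  have := Int.abs_sub_lt_one_of_floor_eq_floor h
  rw [← mul_sub, abs_mul, abs_of_pos (by positivity)] at this
  linarith

theorem eventually_le_card_hitLabels {M : Set ℝ} {t : Finset ℝ} (ht : (t : Set ℝ) ⊆ M) :
    ∀ᶠ n : ℕ in atTop, t.card ≤ (hitLabels n M).card := by
  classical
  have h1 : ∀ᶠ n : ℕ in atTop, ∀ x ∈ t, ⌊2 ^ n * x⌋ ∈ dyadicLabels n :=
    (Finset.eventually_all t).2 fun x _ => eventually_floor_mem_dyadicLabels x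
  have h2 : ∀ᶠ n : ℕ in atTop, ∀ x ∈ t, ∀ y ∈ t, x ≠ y → ⌊2 ^ n * x⌋ ≠ ⌊2 ^ n * y⌋ :=
    (Finset.eventually_all t).2 fun x _ => (Finset.eventually_all t).2 fun y _ => by
      by_cases hxy : x = y
      · exact Eventually.of_forall fun n h => (h hxy).elim
      · filter_upwards [eventually_floor_ne hxy] with n hn _ using hn
  filter_upwards [h1, h2] with n hn1 hn2
  have hinj : InjOn (fun x : ℝ => ⌊2 ^ n * x⌋) t := fun x hx y hy hxy => by
    by_contra hne
    exact hn2 x hx y hy hne hxy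
  rw [← Finset.card_image_of_injOn hinj]
  refine Finset.card_le_card fun k hk => ?_
  obtain ⟨x, hx, rfl⟩ := Finset.mem_image.1 hk
  exact Finset.mem_filter.2 ⟨hn1 x hx, not_disjoint_iff.2 ⟨x, ht hx, rfl⟩⟩

open Classical in
/-- The limit of `ρ ^ (hitLabels n M).card`: the value `ρ ^ |M|`, which is zero if `M` is
infinite. -/
noncomputable def powCard (ρ : ℝ) (M : Set ℝ) : ℝ := if M.Finite then ρ ^ M.ncard else 0

/-- Fine cells separate the points of any finite subset. So the count is eventually `|M|` for finite
`M` and tends to infinity otherwise, where `ρ < 1` kills the power. -/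
theorem tendsto_pow_card_hitLabels {ρ : ℝ} (h0 : 0 ≤ ρ) (h1 : ρ < 1) (M : Set ℝ) :
    Tendsto (fun n => ρ ^ (hitLabels n M).card) atTop (𝓝 (powCard ρ M)) := by
  by_cases hM : M.Finite
  · rw [powCard, if_pos hM]
    refine tendsto_const_nhds.congr' ?_
    filter_upwards [eventually_le_card_hitLabels (M := M) (t := hM.toFinset) (by simp)] with n hn
    rw [← ncard_eq_toFinset_card M hM] at hn
    rw [le_antisymm hn (card_hitLabels_le hM)]
  · rw [powCard, if_neg hM]
    refine (tendsto_pow_atTop_nhds_zero_of_lt_one h0 h1).comp ?_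
    refine tendsto_atTop.2 fun K => ?_
    obtain ⟨t, ht, rfl⟩ := Set.Infinite.exists_subset_card_eq hM K
    exact eventually_le_card_hitLabels ht

theorem powCard_nonneg {ρ : ℝ} (h0 : 0 ≤ ρ) (M : Set ℝ) : 0 ≤ powCard ρ M := by
  rw [powCard]
  split_ifs
  · positivity
  · rfl

theorem powCard_le_one {ρ : ℝ} (h0 : 0 ≤ ρ) (h1 : ρ ≤ 1) (M : Set ℝ) : powCard ρ M ≤ 1 := by
  rw [powCard]
  split_ifs
  · exact pow_le_one₀ h0 h1
  · exact zero_le_one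

/-- No level counts more than `|M|` cells; this is the source of all estimates uniform in the level.
-/
theorem powCard_le {ρ : ℝ} (h0 : 0 ≤ ρ) (h1 : ρ ≤ 1) (n : ℕ) (M : Set ℝ) :
    powCard ρ M ≤ ρ ^ (hitLabels n M).card := by
  rw [powCard]
  split_ifs with h
  · exact pow_le_pow_of_le_one h0 h1 (card_hitLabels_le h)
  · positivity

/-- The event that all hit labels lie in `S` is `M ⊆ allowedSet n S`, hence measurable; removing the
events for proper subsets of `S` isolates equality. -/
theorem measurable_card_hitLabels (n : ℕ) :
    Measurable fun M : Compacts ℝ => (hitLabels n (M : Set ℝ)).card := by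
  let T : Finset ℤ → Set (Compacts ℝ) := fun S => {M | hitLabels n (M : Set ℝ) ⊆ S}
  have hT : ∀ S, MeasurableSet (T S) := fun S => by
    have := measurableSet_subset_compacts (isElementary_allowedSet n S).finite_frontier
    simpa only [subset_allowedSet_iff] using this
  have hE : ∀ S, MeasurableSet {M : Compacts ℝ | hitLabels n (M : Set ℝ) = S} := fun S => by
    have : {M : Compacts ℝ | hitLabels n (M : Set ℝ) = S} = T S \ ⋃ S' ∈ S.ssubsets, T S' := by
      ext M
      simp only [mem_ofPred_eq, Set.mem_sdiff, mem_iUnion, Finset.mem_ssubsets, T,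
        exists_prop, not_exists, not_and]
      constructor
      · rintro rfl
        exact ⟨subset_rfl, fun S' hS' h => hS'.not_subset h⟩
      · rintro ⟨h1, h2⟩
        by_contra hne
        exact h2 _ (Finset.ssubset_iff_subset_ne.2 ⟨h1, hne⟩) subset_rfl
    rw [this]
    exact (hT S).diff (Finset.measurableSet_biUnion _ fun S' _ => hT S')
  refine measurable_to_countable' fun c => ?_
  have : (fun M : Compacts ℝ => (hitLabels n (M : Set ℝ)).card) ⁻¹' {c} =
      ⋃ S ∈ {S : Finset ℤ | S.card = c}, {M : Compacts ℝ | hitLabels n (M : Set ℝ) = S} := by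
    ext M
    simp
  rw [this]
  exact MeasurableSet.biUnion (to_countable _) fun S _ => hE S

theorem measurable_powCard {ρ : ℝ} (h0 : 0 ≤ ρ) (h1 : ρ < 1) :
    Measurable fun M : Compacts ℝ => powCard ρ (M : Set ℝ) :=
  measurable_of_tendsto_metrizable
    (f := fun n (M : Compacts ℝ) => ρ ^ (hitLabels n (M : Set ℝ)).card)
    (fun n => (measurable_from_top (f := fun k : ℕ => ρ ^ k)).comp (measurable_card_hitLabels n))
    (tendsto_pi_nhds.2 fun _ => tendsto_pow_card_hitLabels h0 h1 _)

theorem measurableSet_finite_compacts : MeasurableSet {M : Compacts ℝ | (M : Set ℝ).Finite} := by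
  have h := measurable_powCard (ρ := 1 / 2) (by norm_num) (by norm_num)
  have : {M : Compacts ℝ | (M : Set ℝ).Finite} =
      (fun M : Compacts ℝ => powCard (1 / 2) (M : Set ℝ)) ⁻¹' {0}ᶜ := by
    ext M
    simp [powCard]
  rw [this]
  exact h (measurableSet_singleton _).compl

theorem tendsto_powCard_one {M : Set ℝ} (hM : M.Finite) {ρ : ℕ → ℝ}
    (hρ : Tendsto ρ atTop (𝓝 1)) : Tendsto (fun k => powCard (ρ k) M) atTop (𝓝 1) := by
  simp only [powCard, if_pos hM]
  simpa using hρ.pow M.ncard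

/-- The probability that `S` is the set of labels selected independently with probability `ρ`. -/
noncomputable def labelWeight (ρ : ℝ) (n : ℕ) (S : Finset ℤ) : ℝ :=
  ρ ^ S.card * (1 - ρ) ^ (dyadicLabels n \ S).card

theorem labelWeight_nonneg {ρ : ℝ} (h0 : 0 ≤ ρ) (h1 : ρ ≤ 1) (n : ℕ) (S : Finset ℤ) :
    0 ≤ labelWeight ρ n S :=
  mul_nonneg (pow_nonneg h0 _) (pow_nonneg (sub_nonneg.2 h1) _)

theorem sum_labelWeight_of_subset {ρ : ℝ} {n : ℕ} {T : Finset ℤ} (hT : T ⊆ dyadicLabels n) :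
    ∑ S ∈ (dyadicLabels n).powerset, (if T ⊆ S then labelWeight ρ n S else 0) = ρ ^ T.card := by
  classical
  -- Expand a product whose factor is `ρ` on `T` and `ρ + (1 - ρ) = 1` elsewhere: the surviving
  -- terms are the selections containing `T`.
  have h := Finset.prod_add (fun _ : ℤ => ρ) (fun i => if i ∈ T then 0 else 1 - ρ) (dyadicLabels n)
  have h1 : ∏ i ∈ dyadicLabels n, (ρ + if i ∈ T then 0 else 1 - ρ) = ρ ^ T.card := by
    rw [← Finset.prod_subset hT (f := fun i => ρ + if i ∈ T then 0 else 1 - ρ)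
      (fun i _ hi => by simp [hi])]
    rw [← Finset.prod_const]
    exact Finset.prod_congr rfl fun i hi => by simp [hi]
  rw [← h1, h]
  refine Finset.sum_congr rfl fun S hS => ?_
  rw [Finset.prod_const]
  split_ifs with hTS
  · rw [labelWeight, ← Finset.prod_const (s := dyadicLabels n \ S)]
    congr 1
    refine Finset.prod_congr rfl fun i hi => ?_
    rw [if_neg fun hiT => (Finset.mem_sdiff.1 hi).2 (hTS hiT)]
  · obtain ⟨i, hiT, hiS⟩ := Finset.not_subset.1 hTS
    rw [Finset.prod_eq_zero (Finset.mem_sdiff.2 ⟨hT hiT, hiS⟩) (by simp [hiT]), mul_zero]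

theorem sum_labelWeight (ρ : ℝ) (n : ℕ) :
    ∑ S ∈ (dyadicLabels n).powerset, labelWeight ρ n S = 1 := by
  simpa using sum_labelWeight_of_subset (ρ := ρ) (n := n) (Finset.empty_subset _)

end DyadicCells

/-! ### Functional calculus over the spectral measure, and the noise operators. -/

namespace ElementaryProjections

variable {H : Type*} [NormedAddCommGroup H] [InnerProductSpace ℝ H] (Q : ElementaryProjections H)

/-- `Q.HasSymbol A a`: the operator `A` is a linear combination of projections `Q.proj E`, and `a`
is the same linear combination of the indicators of the sets `{M | M ⊆ E}`. -/
inductive HasSymbol : (H →L[ℝ] H) → (Compacts ℝ → ℝ) → Prop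
  | proj {E : Set ℝ} (hE : IsElementary E) :
      HasSymbol (Q.proj E) ({M : Compacts ℝ | (M : Set ℝ) ⊆ E}.indicator 1)
  | zero : HasSymbol 0 0
  | smul_add (c : ℝ) {A B : H →L[ℝ] H} {a b : Compacts ℝ → ℝ} (hA : HasSymbol A a)
      (hB : HasSymbol B b) : HasSymbol (c • A + B) (c • a + b)

/-- `μ` is the spectral measure of the vector `x`. -/
def IsSpectral (x : H) (μ : Measure (Compacts ℝ)) : Prop :=
  ∀ E, IsElementary E → μ {M | (M : Set ℝ) ⊆ E} = ENNReal.ofReal (‖Q.proj E x‖ ^ 2)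

variable {Q}

namespace HasSymbol

variable {A B : H →L[ℝ] H} {a b : Compacts ℝ → ℝ}

theorem sub (hA : Q.HasSymbol A a) (hB : Q.HasSymbol B b) : Q.HasSymbol (A - B) (a - b) := by
  simpa [neg_add_eq_sub] using hB.smul_add (-1) hA

theorem sum {ι : Type*} {s : Finset ι} {c : ι → ℝ} {E : ι → Set ℝ}
    (hE : ∀ i ∈ s, IsElementary (E i)) :
    Q.HasSymbol (∑ i ∈ s, c i • Q.proj (E i))
      (∑ i ∈ s, c i • {M : Compacts ℝ | (M : Set ℝ) ⊆ E i}.indicator 1) := by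
  classical
  induction s using Finset.induction_on with
  | empty => exact zero
  | insert i s hi ih =>
    rw [Finset.sum_insert hi, Finset.sum_insert hi]
    exact (proj (hE i (Finset.mem_insert_self _ _))).smul_add _
      (ih fun j hj => hE j (Finset.mem_insert_of_mem hj))

theorem one : Q.HasSymbol (ContinuousLinearMap.id ℝ H) 1 := by
  have h : Q.proj univ = ContinuousLinearMap.id ℝ H := by
    ext x
    exact Q.proj_univ x
  simpa [h] using proj (Q := Q) isElementary_univ

/-- Both products reduce to intersection: projections by commutation, indicators because `M ⊆ E` and
`M ⊆ E'` together mean `M ⊆ E ∩ E'`. -/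
theorem comp (hA : Q.HasSymbol A a) (hB : Q.HasSymbol B b) : Q.HasSymbol (A.comp B) (a * b) := by
  induction hA with
  | @proj E hE =>
    induction hB with
    | @proj E' hE' =>
      have h1 : (Q.proj E).comp (Q.proj E') = Q.proj (E ∩ E') := by
        ext x
        exact Q.proj_proj E E' hE hE' x
      have h2 : ({M : Compacts ℝ | (M : Set ℝ) ⊆ E}.indicator 1 *
          {M : Compacts ℝ | (M : Set ℝ) ⊆ E'}.indicator 1 : Compacts ℝ → ℝ) =
          {M : Compacts ℝ | (M : Set ℝ) ⊆ E ∩ E'}.indicator 1 := by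
        rw [← inter_indicator_one]
        simp only [subset_inter_iff, ofPred_and]
      rw [h1, h2]
      exact proj (hE.inter hE')
    | zero => simpa using zero
    | smul_add c _ _ ih ih' =>
      rw [ContinuousLinearMap.comp_add, ContinuousLinearMap.comp_smul, mul_add, mul_smul_comm]
      exact ih.smul_add c ih'
  | zero => simpa using zero
  | smul_add c _ _ ih ih' =>
    rw [ContinuousLinearMap.add_comp, ContinuousLinearMap.smul_comp, add_mul, smul_mul_assoc]
    exact ih.smul_add c ih'

theorem inner_left (hA : Q.HasSymbol A a) (x y : H) : inner ℝ (A x) y = inner ℝ x (A y) := by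
  induction hA with
  | proj hE => exact Q.inner_proj _ x y
  | zero => simp
  | smul_add c _ _ ih ih' =>
    simp [inner_add_left, inner_add_right, inner_smul_left, inner_smul_right, ih, ih']

theorem inner_eq_integral (hA : Q.HasSymbol A a) {x : H} {μ : Measure (Compacts ℝ)}
    [IsFiniteMeasure μ] (hμ : Q.IsSpectral x μ) :
    Integrable a μ ∧ inner ℝ x (A x) = ∫ M, a M ∂μ := by
  induction hA with
  | @proj E hE =>
    have hm := measurableSet_subset_compacts hE.finite_frontier
    refine ⟨(integrable_const (1 : ℝ)).indicator hm, ?_⟩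
    rw [integral_indicator_one hm, measureReal_def, hμ E hE, ENNReal.toReal_ofReal (by positivity),
      Q.norm_sq_proj hE]
  | zero => simp
  | smul_add c _ _ ih ih' =>
    refine ⟨(ih.1.smul c).add ih'.1, ?_⟩
    rw [integral_add' (ih.1.smul c) ih'.1, Pi.smul_def, integral_smul, ← ih.2, ← ih'.2]
    simp [inner_add_right, inner_smul_right]

theorem norm_sq_eq_integral (hA : Q.HasSymbol A a) {x : H} {μ : Measure (Compacts ℝ)}
    [IsFiniteMeasure μ] (hμ : Q.IsSpectral x μ) : ‖A x‖ ^ 2 = ∫ M, a M ^ 2 ∂μ := by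
  rw [← real_inner_self_eq_norm_sq, hA.inner_left]
  have := ((hA.comp hA).inner_eq_integral hμ).2
  simpa [sq] using this

end HasSymbol

variable (Q)

/-- The noise operator of level `n`: every dyadic cell of level `n` inside `[-n, n)` is kept with
probability `ρ` and averaged out otherwise. -/
noncomputable def noise (ρ : ℝ) (n : ℕ) : H →L[ℝ] H :=
  ∑ S ∈ (dyadicLabels n).powerset, labelWeight ρ n S • Q.proj (allowedSet n S)

/-- The inclusion `M ⊆ allowedSet n S` says that `S` contains all hit labels, and a random selection
does so with probability `ρ ^ N`. -/
theorem hasSymbol_noise (ρ : ℝ) (n : ℕ) :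
    Q.HasSymbol (Q.noise ρ n) fun M => ρ ^ (hitLabels n (M : Set ℝ)).card := by
  have h := HasSymbol.sum (Q := Q) (s := (dyadicLabels n).powerset) (c := labelWeight ρ n)
    (E := allowedSet n) fun S _ => isElementary_allowedSet n S
  rw [noise]
  convert h using 1
  funext M
  classical
  rw [← sum_labelWeight_of_subset (T := hitLabels n (M : Set ℝ)) (n := n)
    (Finset.filter_subset _ _), Finset.sum_apply]
  refine Finset.sum_congr rfl fun S _ => ?_
  simp [indicator_apply, subset_allowedSet_iff]

end ElementaryProjections

/-! ### Limits of integrals of the noise symbol. -/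

section HitPow

/-- The symbol `ρ ^ N` of the noise operator, with `N` the number of dyadic cells hit. -/
noncomputable def hitPow (ρ : ℝ) (n : ℕ) (M : Compacts ℝ) : ℝ := ρ ^ (hitLabels n (M : Set ℝ)).card

theorem measurable_hitPow (ρ : ℝ) (n : ℕ) : Measurable (hitPow ρ n) :=
  (measurable_from_top (f := fun k : ℕ => ρ ^ k)).comp (measurable_card_hitLabels n)

variable {ρ : ℝ}

theorem hitPow_nonneg (h0 : 0 ≤ ρ) (n : ℕ) (M : Compacts ℝ) : 0 ≤ hitPow ρ n M :=
  pow_nonneg h0 _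

theorem hitPow_le_one (h0 : 0 ≤ ρ) (h1 : ρ ≤ 1) (n : ℕ) (M : Compacts ℝ) : hitPow ρ n M ≤ 1 :=
  pow_le_one₀ h0 h1

theorem tendsto_hitPow (h0 : 0 ≤ ρ) (h1 : ρ < 1) (M : Compacts ℝ) :
    Tendsto (fun n => hitPow ρ n M) atTop (𝓝 (powCard ρ M)) :=
  tendsto_pow_card_hitLabels h0 h1 _

/-- Replacing `hitPow ρ n` by the smaller `powCard ρ` removes `n`. As `ρ → 1` the integrand then
vanishes on finite sets, while `g` vanishes on infinite ones; dominated convergence applies. -/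
theorem exists_forall_integral_mul_one_sub_hitPow_le {μ : Measure (Compacts ℝ)}
    [IsFiniteMeasure μ] {g : Compacts ℝ → ℝ} (hg : Measurable g) (h0 : ∀ M, 0 ≤ g M)
    (h1 : ∀ M, g M ≤ 1) (hinf : ∀ᵐ M : Compacts ℝ ∂μ, (M : Set ℝ).Infinite → g M = 0) {ε : ℝ}
    (hε : 0 < ε) :
    ∃ ρ ∈ Ioo (0 : ℝ) 1, ∀ n, ∫ M, g M * (1 - hitPow ρ n M) ∂μ ≤ ε := by
  -- The shift by two keeps `ρ 0` positive.
  let ρ : ℕ → ℝ := fun k => 1 - 1 / (k + 2)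
  have hρ : ∀ k, ρ k ∈ Ioo (0 : ℝ) 1 := fun k => by
    have : (0 : ℝ) < k + 2 := by positivity
    constructor
    · simp only [ρ, sub_pos]
      rw [div_lt_one this]
      linarith [k.cast_nonneg (α := ℝ)]
    · simp only [ρ, sub_lt_self_iff]
      positivity
  have hρ1 : Tendsto ρ atTop (𝓝 1) := by
    have h := (tendsto_one_div_add_atTop_nhds_zero_nat (𝕜 := ℝ)).comp (tendsto_add_atTop_nat 1)
    have h2 : Tendsto (fun k : ℕ => 1 - 1 / ((k : ℝ) + 2)) atTop (𝓝 (1 - 0)) := by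
      refine (h.congr fun k => ?_).const_sub 1
      simp only [Function.comp_apply]
      push_cast
      ring_nf
    rwa [sub_zero] at h2
  have hbound : ∀ {t : ℝ} (M), 0 ≤ t → t ≤ 1 → |g M * (1 - t)| ≤ 1 := fun {t} M ht0 ht1 => by
    rw [abs_of_nonneg (mul_nonneg (h0 M) (by linarith))]
    exact mul_le_one₀ (h1 M) (by linarith) (by linarith)
  have hmeas : ∀ k, Measurable fun M : Compacts ℝ => g M * (1 - powCard (ρ k) M) := fun k =>
    hg.mul (measurable_const.sub (measurable_powCard (hρ k).1.le (hρ k).2))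
  have hlim : Tendsto (fun k => ∫ M, g M * (1 - powCard (ρ k) (M : Set ℝ)) ∂μ) atTop
      (𝓝 (∫ _, (0 : ℝ) ∂μ)) := by
    refine tendsto_integral_of_dominated_convergence (fun _ => 1)
      (fun k => (hmeas k).aestronglyMeasurable) (integrable_const _)
      (fun k => Eventually.of_forall fun M => ?_) ?_
    · exact hbound M (powCard_nonneg (hρ k).1.le _) (powCard_le_one (hρ k).1.le (hρ k).2.le _)
    · filter_upwards [hinf] with M hM
      by_cases hfin : (M : Set ℝ).Finite
      · simpa using ((tendsto_powCard_one hfin hρ1).const_sub 1).const_mul (g M)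
      · simp [hM hfin]
  rw [integral_zero] at hlim
  obtain ⟨k, hk⟩ := (hlim.eventually_lt_const hε).exists
  refine ⟨ρ k, hρ k, fun n => (integral_mono ?_ ?_ fun M => ?_).trans hk.le⟩
  · refine Integrable.of_bound (hg.mul (measurable_const.sub
      (measurable_hitPow _ _))).aestronglyMeasurable 1 (Eventually.of_forall fun M => ?_)
    exact hbound M (hitPow_nonneg (hρ k).1.le _ _) (hitPow_le_one (hρ k).1.le (hρ k).2.le _ _)
  · refine Integrable.of_bound (hmeas k).aestronglyMeasurable 1 (Eventually.of_forall fun M => ?_)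
    exact hbound M (powCard_nonneg (hρ k).1.le _) (powCard_le_one (hρ k).1.le (hρ k).2.le _)
  · exact mul_le_mul_of_nonneg_left (sub_le_sub_left (powCard_le (hρ k).1.le (hρ k).2.le n _) 1)
      (h0 M)

variable {μ : Measure (Compacts ℝ)} [IsFiniteMeasure μ]

theorem tendsto_integral_hitPow (h0 : 0 ≤ ρ) (h1 : ρ < 1) :
    Tendsto (fun n => ∫ M, hitPow ρ n M ∂μ) atTop (𝓝 (∫ M : Compacts ℝ, powCard ρ M ∂μ)) := by
  refine tendsto_integral_of_dominated_convergence (fun _ => 1)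
    (fun n => (measurable_hitPow ρ n).aestronglyMeasurable) (integrable_const _)
    (fun n => Eventually.of_forall fun M => ?_) (Eventually.of_forall (tendsto_hitPow h0 h1))
  rw [Real.norm_of_nonneg (hitPow_nonneg h0 _ _)]
  exact hitPow_le_one h0 h1.le _ _

theorem tendsto_integral_sq_hitPow_mul (h0 : 0 ≤ ρ) (h1 : ρ < 1) {g : Compacts ℝ → ℝ}
    (hg : Measurable g) (hg0 : ∀ M, 0 ≤ g M) (hg1 : ∀ M, g M ≤ 1) :
    Tendsto (fun n => ∫ M, hitPow ρ n M ^ 2 * g M ∂μ) atTop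
      (𝓝 (∫ M : Compacts ℝ, powCard ρ M ^ 2 * g M ∂μ)) := by
  refine tendsto_integral_of_dominated_convergence (fun _ => 1)
    (fun n => (((measurable_hitPow ρ n).pow_const 2).mul hg).aestronglyMeasurable)
    (integrable_const _) (fun n => Eventually.of_forall fun M => ?_)
    (Eventually.of_forall fun M => ((tendsto_hitPow h0 h1 M).pow 2).mul_const _)
  rw [Real.norm_of_nonneg (mul_nonneg (sq_nonneg _) (hg0 M))]
  exact mul_le_one₀ (pow_le_one₀ (hitPow_nonneg h0 _ _) (hitPow_le_one h0 h1.le _ _)) (hg0 M)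
    (hg1 M)

theorem tendsto_integral_sq_hitPow_sub (h0 : 0 ≤ ρ) (h1 : ρ < 1) :
    Tendsto (fun n => ∫ M, (hitPow ρ n M - powCard ρ M) ^ 2 ∂μ) atTop (𝓝 0) := by
  have : Tendsto (fun n => ∫ M, (hitPow ρ n M - powCard ρ M) ^ 2 ∂μ) atTop
      (𝓝 (∫ _, (0 : ℝ) ∂μ)) := by
    refine tendsto_integral_of_dominated_convergence (fun _ => 1)
      (fun n => (((measurable_hitPow ρ n).sub
        (measurable_powCard h0 h1)).pow_const 2).aestronglyMeasurable)
      (integrable_const _) (fun n => Eventually.of_forall fun M => ?_)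
      (Eventually.of_forall fun M => ?_)
    · rw [Real.norm_of_nonneg (sq_nonneg _), sq_le_one_iff_abs_le_one, abs_le]
      have h2 := hitPow_nonneg h0 n M
      have h3 := hitPow_le_one h0 h1.le n M
      have h4 := powCard_nonneg h0 (M : Set ℝ)
      have h5 := powCard_le_one h0 h1.le (M : Set ℝ)
      constructor <;> linarith
    · simpa using ((tendsto_hitPow h0 h1 M).sub_const (powCard ρ M)).pow 2
  simpa using this

end HitPow

/-! ### Stable vectors and their orthogonal complement. -/

namespace ElementaryProjections

variable {H : Type*} [NormedAddCommGroup H] [InnerProductSpace ℝ H] (Q : ElementaryProjections H)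

/-- The mean squared distance between `x` and its projections on randomly thinned sets. -/
noncomputable def defect (ρ : ℝ) (n : ℕ) (x : H) : ℝ :=
  ∑ S ∈ (dyadicLabels n).powerset, labelWeight ρ n S * ‖x - Q.proj (allowedSet n S) x‖ ^ 2

theorem defect_eq (ρ : ℝ) (n : ℕ) (x : H) :
    Q.defect ρ n x = ‖x‖ ^ 2 - inner ℝ x (Q.noise ρ n x) := by
  simp only [defect, noise, Q.norm_sq_sub_proj (isElementary_allowedSet _ _), mul_sub,
    Finset.sum_sub_distrib, ← Finset.sum_mul, sum_labelWeight, one_mul,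
    _root_.sum_apply, inner_sum, _root_.smul_apply, inner_smul_right,
    Q.norm_sq_proj (isElementary_allowedSet _ _)]

theorem continuous_defect (ρ : ℝ) (n : ℕ) : Continuous (Q.defect ρ n) := by
  unfold defect
  fun_prop

theorem defect_eq_integral {ρ : ℝ} (n : ℕ) {x : H} {μ : Measure (Compacts ℝ)} [IsFiniteMeasure μ]
    (hμ : Q.IsSpectral x μ) : Q.defect ρ n x = ∫ M, (1 - hitPow ρ n M) ∂μ := by
  rw [defect_eq, ← real_inner_self_eq_norm_sq, ← inner_sub_right]
  exact ((HasSymbol.one.sub (Q.hasSymbol_noise ρ n)).inner_eq_integral hμ).2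

/-- The symbol `1 - hitPow ρ n` has values in `[0, 1]`, so its square is at most itself. -/
theorem norm_sq_sub_noise_le_defect {ρ : ℝ} (h0 : 0 ≤ ρ) (h1 : ρ ≤ 1) (n : ℕ) (x : H) :
    ‖x - Q.noise ρ n x‖ ^ 2 ≤ Q.defect ρ n x := by
  obtain ⟨μ, hfin, hμ⟩ := Q.exists_spectralMeasure x
  have h := (HasSymbol.one.sub (Q.hasSymbol_noise ρ n))
  have h2 := h.norm_sq_eq_integral hμ
  have h3 : ‖x - Q.noise ρ n x‖ ^ 2 = ∫ M, (1 - hitPow ρ n M) ^ 2 ∂μ := h2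
  rw [Q.defect_eq_integral n hμ, h3]
  have hm : Measurable fun M => 1 - hitPow ρ n M := measurable_const.sub (measurable_hitPow ρ n)
  have hb : ∀ M, 0 ≤ 1 - hitPow ρ n M ∧ 1 - hitPow ρ n M ≤ 1 := fun M =>
    ⟨by linarith [hitPow_le_one h0 h1 n M], by linarith [hitPow_nonneg h0 n M]⟩
  refine integral_mono ?_ ?_ fun M => ?_
  · refine Integrable.of_bound (hm.pow_const 2).aestronglyMeasurable 1
      (Eventually.of_forall fun M => ?_)
    rw [Real.norm_of_nonneg (sq_nonneg _)]
    exact pow_le_one₀ (hb M).1 (hb M).2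
  · refine Integrable.of_bound hm.aestronglyMeasurable 1 (Eventually.of_forall fun M => ?_)
    rw [Real.norm_of_nonneg (hb M).1]
    exact (hb M).2
  · exact pow_le_of_le_one (hb M).1 (hb M).2 two_ne_zero

/-- A vector is stable if the defect can be made small uniformly in the level. -/
def IsStableVector (x : H) : Prop := ∀ ε > 0, ∃ ρ ∈ Ioo (0 : ℝ) 1, ∀ n, Q.defect ρ n x ≤ ε

/-- As the level grows, the defect tends to the integral of `1 - ρ ^ |M|`, which is at least the
mass of the infinite sets. If that mass is zero, the uniform estimate applies with `g = 1`. -/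
theorem isStableVector_iff {x : H} {μ : Measure (Compacts ℝ)} [IsFiniteMeasure μ]
    (hμ : Q.IsSpectral x μ) :
    Q.IsStableVector x ↔ μ {M : Compacts ℝ | (M : Set ℝ).Infinite} = 0 := by
  constructor
  · intro h
    have hm : MeasurableSet {M : Compacts ℝ | (M : Set ℝ).Infinite} :=
      measurableSet_finite_compacts.compl
    rw [← measureReal_eq_zero_iff]
    refine le_antisymm (le_of_forall_pos_le_add fun ε hε => ?_) measureReal_nonneg
    obtain ⟨ρ, ⟨h0, h1⟩, hρ⟩ := h ε hε
    have hlim : Tendsto (fun n => Q.defect ρ n x) atTop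
        (𝓝 (∫ M : Compacts ℝ, (1 - powCard ρ (M : Set ℝ)) ∂μ)) := by
      simp_rw [Q.defect_eq_integral _ hμ]
      refine tendsto_integral_of_dominated_convergence (fun _ => 1)
        (fun n => (measurable_const.sub (measurable_hitPow ρ n)).aestronglyMeasurable)
        (integrable_const _) (fun n => Eventually.of_forall fun M => ?_)
        (Eventually.of_forall fun M => (tendsto_hitPow h0.le h1 M).const_sub 1)
      have h2 := hitPow_nonneg h0.le n M
      have h3 := hitPow_le_one h0.le h1.le n M
      rw [Real.norm_eq_abs, abs_le]
      constructor <;> linarith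
    refine le_trans ?_ ((le_of_tendsto' hlim hρ).trans (zero_add ε).ge)
    rw [← integral_indicator_one hm]
    refine integral_mono ((integrable_const (1 : ℝ)).indicator hm) ?_ fun M => ?_
    · refine Integrable.of_bound (measurable_const.sub
        (measurable_powCard h0.le h1)).aestronglyMeasurable 1 (Eventually.of_forall fun M => ?_)
      have h2 := powCard_nonneg h0.le (M : Set ℝ)
      have h3 := powCard_le_one h0.le h1.le (M : Set ℝ)
      rw [Real.norm_eq_abs, abs_le]
      constructor <;> linarith
    · by_cases hM : (M : Set ℝ).Infinite
      · rw [indicator_of_mem (show M ∈ {M : Compacts ℝ | (M : Set ℝ).Infinite} from hM), powCard,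
          if_neg hM]
        simp
      · rw [indicator_of_notMem (show M ∉ {M : Compacts ℝ | (M : Set ℝ).Infinite} from hM)]
        exact sub_nonneg.2 (powCard_le_one h0.le h1.le _)
  · intro h ε hε
    have hinf : ∀ᵐ M : Compacts ℝ ∂μ, (M : Set ℝ).Infinite → (1 : ℝ) = 0 := by
      refine (measure_eq_zero_iff_ae_notMem.1 h).mono fun M hM hM' => (hM hM').elim
    obtain ⟨ρ, hρ, hle⟩ := exists_forall_integral_mul_one_sub_hitPow_le (μ := μ)
      (g := fun _ => 1) measurable_const (fun _ => zero_le_one) (fun _ => le_rfl) hinf hε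
    refine ⟨ρ, hρ, fun n => ?_⟩
    rw [Q.defect_eq_integral n hμ]
    simpa using hle n

/-- Differences of noise operators applied to `x` have the norm of the differences of symbols in L²
of the spectral measure, where the symbols converge. -/
theorem exists_tendsto_noise [CompleteSpace H] {ρ : ℝ} (h0 : 0 ≤ ρ) (h1 : ρ < 1) (x : H) :
    ∃ y, Tendsto (fun n => Q.noise ρ n x) atTop (𝓝 y) := by
  obtain ⟨μ, hfin, hμ⟩ := Q.exists_spectralMeasure x
  refine cauchySeq_tendsto_of_complete (Metric.cauchySeq_iff'.2 fun ε hε => ?_)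
  have hint : ∀ n, Integrable (fun M => (hitPow ρ n M - powCard ρ (M : Set ℝ)) ^ 2) μ := fun n => by
    refine Integrable.of_bound (((measurable_hitPow ρ n).sub
      (measurable_powCard h0 h1)).pow_const 2).aestronglyMeasurable 1
      (Eventually.of_forall fun M => ?_)
    rw [Real.norm_of_nonneg (sq_nonneg _), sq_le_one_iff_abs_le_one, abs_le]
    have h2 := hitPow_nonneg h0 n M
    have h3 := hitPow_le_one h0 h1.le n M
    have h4 := powCard_nonneg h0 (M : Set ℝ)
    have h5 := powCard_le_one h0 h1.le (M : Set ℝ)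
    constructor <;> linarith
  have hdist : ∀ m n, ‖Q.noise ρ m x - Q.noise ρ n x‖ ^ 2 ≤
      2 * ∫ M, (hitPow ρ m M - powCard ρ (M : Set ℝ)) ^ 2 ∂μ +
        2 * ∫ M, (hitPow ρ n M - powCard ρ (M : Set ℝ)) ^ 2 ∂μ := fun m n => by
    have h2 := ((Q.hasSymbol_noise ρ m).sub (Q.hasSymbol_noise ρ n))
    have h3 := (h2.comp h2).inner_eq_integral hμ
    have h4 : ‖Q.noise ρ m x - Q.noise ρ n x‖ ^ 2 = ∫ M, (hitPow ρ m M - hitPow ρ n M) ^ 2 ∂μ :=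
      h2.norm_sq_eq_integral hμ
    rw [h4, ← integral_const_mul, ← integral_const_mul,
      ← integral_add ((hint m).const_mul 2) ((hint n).const_mul 2)]
    refine integral_mono ?_ (((hint m).const_mul 2).add ((hint n).const_mul 2)) fun M => ?_
    · refine h3.1.congr (Eventually.of_forall fun M => ?_)
      simp [hitPow, sq]
    · simp only
      nlinarith [sq_nonneg (hitPow ρ m M - powCard ρ (M : Set ℝ) +
        (hitPow ρ n M - powCard ρ (M : Set ℝ)))]
  obtain ⟨N, hN⟩ := eventually_atTop.1 ((tendsto_integral_sq_hitPow_sub (μ := μ) h0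
    h1).eventually_lt_const (show 0 < ε ^ 2 / 4 by positivity))
  refine ⟨N, fun n hn => ?_⟩
  rw [dist_eq_norm]
  have h2 := hdist n N
  have h3 := hN n hn
  have h4 := hN N le_rfl
  exact lt_of_pow_lt_pow_left₀ 2 hε.le (by linarith)

/-- In effect `y` has spectral density `ρ ^ (2 * |M|)` with respect to that of `x`, and this density
vanishes on infinite sets; it serves as `g` in the uniform estimate. -/
theorem isStableVector_of_tendsto_noise {ρ : ℝ} (h0 : 0 ≤ ρ) (h1 : ρ < 1) {x y : H}
    (hy : Tendsto (fun n => Q.noise ρ n x) atTop (𝓝 y)) : Q.IsStableVector y := by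
  obtain ⟨μ, hfin, hμ⟩ := Q.exists_spectralMeasure x
  intro ε hε
  obtain ⟨σ, hσ, hle⟩ := exists_forall_integral_mul_one_sub_hitPow_le (μ := μ)
    (g := fun M => powCard ρ (M : Set ℝ) ^ 2) ((measurable_powCard h0 h1).pow_const 2)
    (fun M => sq_nonneg _) (fun M => pow_le_one₀ (powCard_nonneg h0 _) (powCard_le_one h0 h1.le _))
    (Eventually.of_forall fun M hM => by
      have : ¬ (M : Set ℝ).Finite := hM
      simp [powCard, this]) hε
  refine ⟨σ, hσ, fun m => ?_⟩
  have hlim1 := ((Q.continuous_defect σ m).tendsto y).comp hy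
  have hlim2 := tendsto_integral_sq_hitPow_mul (μ := μ) h0 h1 (g := fun M => 1 - hitPow σ m M)
    (measurable_const.sub (measurable_hitPow σ m))
    (fun M => sub_nonneg.2 (hitPow_le_one hσ.1.le hσ.2.le m M))
    (fun M => sub_le_self _ (hitPow_nonneg hσ.1.le m M))
  have heq : ∀ n, (Q.defect σ m ∘ fun n => Q.noise ρ n x) n =
      ∫ M, hitPow ρ n M ^ 2 * (1 - hitPow σ m M) ∂μ := fun n => by
    have hU := Q.hasSymbol_noise ρ n
    have hV := HasSymbol.one.sub (Q.hasSymbol_noise σ m)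
    have h := ((hU.comp (hV.comp hU)).inner_eq_integral hμ).2
    rw [Function.comp_apply, defect_eq, ← real_inner_self_eq_norm_sq, ← inner_sub_right,
      hU.inner_left]
    refine h.trans (integral_congr_ae (Eventually.of_forall fun M => ?_))
    simp only [Pi.mul_apply, Pi.sub_apply, Pi.one_apply, hitPow]
    ring
  rw [tendsto_nhds_unique (hlim1.congr heq) hlim2]
  exact hle m

/-- If `x` is orthogonal to stable vectors, test it against the limit of its own noise with `ρ = 1 /
2`: the integral of `(1 / 2) ^ |M|` is zero, so finite sets have no mass. Conversely, noise with a
fixed `ρ < 1` asymptotically annihilates `x` but barely moves a stable `y`. -/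
theorem forall_isStableVector_inner_eq_zero_iff [CompleteSpace H] {x : H}
    {μ : Measure (Compacts ℝ)} [IsFiniteMeasure μ] (hμ : Q.IsSpectral x μ) :
    (∀ y, Q.IsStableVector y → inner ℝ y x = 0) ↔
      μ {M : Compacts ℝ | (M : Set ℝ).Finite} = 0 := by
  constructor
  · intro h
    have h0 : (0 : ℝ) ≤ 1 / 2 := by norm_num
    have h1 : (1 / 2 : ℝ) < 1 := by norm_num
    obtain ⟨y, hy⟩ := Q.exists_tendsto_noise h0 h1 x
    have hlim1 : Tendsto (fun n => inner ℝ x (Q.noise (1 / 2) n x)) atTop (𝓝 (inner ℝ x y)) :=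
      tendsto_const_nhds.inner hy
    have hlim2 := tendsto_integral_hitPow (μ := μ) h0 h1
    have heq : ∀ n, inner ℝ x (Q.noise (1 / 2) n x) = ∫ M, hitPow (1 / 2) n M ∂μ := fun n =>
      ((Q.hasSymbol_noise (1 / 2) n).inner_eq_integral hμ).2
    have h2 := tendsto_nhds_unique (hlim1.congr heq) hlim2
    rw [real_inner_comm, h y (Q.isStableVector_of_tendsto_noise h0 h1 hy)] at h2
    have hint : Integrable (fun M : Compacts ℝ => powCard (1 / 2) (M : Set ℝ)) μ := by
      refine Integrable.of_bound (measurable_powCard h0 h1).aestronglyMeasurable 1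
        (Eventually.of_forall fun M => ?_)
      rw [Real.norm_of_nonneg (powCard_nonneg h0 _)]
      exact powCard_le_one h0 h1.le _
    have h3 := (integral_eq_zero_iff_of_nonneg
      (fun M : Compacts ℝ => powCard_nonneg h0 (M : Set ℝ)) hint).1 h2.symm
    refine measure_eq_zero_iff_ae_notMem.2 (h3.mono fun M hM hfin => ?_)
    have h4 : (M : Set ℝ).Finite := hfin
    simp [powCard, h4] at hM
  · intro h y hy
    have key : ∀ ε > 0, |inner ℝ y x| ≤ Real.sqrt ε * ‖x‖ := by
      intro ε hε
      obtain ⟨ρ, ⟨h0, h1⟩, hρ⟩ := hy ε hε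
      have hlim : Tendsto (fun n => ‖Q.noise ρ n x‖ ^ 2) atTop (𝓝 0) := by
        have h2 := tendsto_integral_sq_hitPow_mul (μ := μ) h0.le h1 (g := fun _ => 1)
          measurable_const (fun _ => zero_le_one) (fun _ => le_rfl)
        have h3 : ∫ M : Compacts ℝ, powCard ρ (M : Set ℝ) ^ 2 * 1 ∂μ = 0 := by
          rw [← integral_zero (Compacts ℝ) ℝ (μ := μ)]
          refine integral_congr_ae ((measure_eq_zero_iff_ae_notMem.1 h).mono fun M hM => ?_)
          have : ¬ (M : Set ℝ).Finite := hM
          simp [powCard, this]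
        rw [h3] at h2
        refine h2.congr fun n => ?_
        rw [(Q.hasSymbol_noise ρ n).norm_sq_eq_integral hμ]
        simp [hitPow]
      have hlim' : Tendsto (fun n => Real.sqrt ε * ‖x‖ + ‖y‖ * ‖Q.noise ρ n x‖) atTop
          (𝓝 (Real.sqrt ε * ‖x‖)) := by
        have h2 := hlim.sqrt
        simp only [Real.sqrt_sq (norm_nonneg _), Real.sqrt_zero] at h2
        simpa using (h2.const_mul ‖y‖).const_add (Real.sqrt ε * ‖x‖)
      refine ge_of_tendsto hlim' (Eventually.of_forall fun n => ?_)
      -- Self-adjointness moves the noise from `y` to `x`. The first term is small for all `n` with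
      -- `ρ` fixed, so `n` may tend to infinity in the second.
      have h2 : inner ℝ y x = inner ℝ (y - Q.noise ρ n y) x + inner ℝ y (Q.noise ρ n x) := by
        rw [inner_sub_left, (Q.hasSymbol_noise ρ n).inner_left]
        ring
      have h3 : ‖y - Q.noise ρ n y‖ ≤ Real.sqrt ε := by
        refine Real.le_sqrt_of_sq_le ?_
        exact (Q.norm_sq_sub_noise_le_defect h0.le h1.le n y).trans (hρ n)
      rw [h2]
      refine (abs_add_le _ _).trans (add_le_add ?_ (abs_real_inner_le_norm _ _))
      exact (abs_real_inner_le_norm _ _).trans (mul_le_mul_of_nonneg_right h3 (norm_nonneg _))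
    have hlim : Tendsto (fun ε : ℝ => Real.sqrt ε * ‖x‖) (𝓝[>] 0) (𝓝 0) := by
      have : Tendsto (fun ε : ℝ => Real.sqrt ε * ‖x‖) (𝓝 0) (𝓝 (Real.sqrt 0 * ‖x‖)) :=
        (Real.continuous_sqrt.tendsto 0).mul_const _
      rw [Real.sqrt_zero, zero_mul] at this
      exact this.mono_left nhdsWithin_le_nhds
    exact abs_eq_zero.1 (le_antisymm (ge_of_tendsto hlim
      (eventually_nhdsWithin_of_forall fun ε hε => key ε hε)) (abs_nonneg _))

end ElementaryProjections

/-! ### Masses of the finite and infinite sets do not depend on the spectral measure chosen. -/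

section Uniqueness

theorem hitPow_eq_sum (ρ : ℝ) (n : ℕ) (M : Compacts ℝ) :
    hitPow ρ n M = ∑ S ∈ (dyadicLabels n).powerset,
      labelWeight ρ n S * {M : Compacts ℝ | (M : Set ℝ) ⊆ allowedSet n S}.indicator 1 M := by
  classical
  rw [hitPow, ← sum_labelWeight_of_subset (T := hitLabels n (M : Set ℝ)) (n := n)
    (Finset.filter_subset _ _)]
  refine Finset.sum_congr rfl fun S _ => ?_
  simp [indicator_apply, subset_allowedSet_iff]

theorem integral_hitPow_eq {μ ν : Measure (Compacts ℝ)} [IsFiniteMeasure μ] [IsFiniteMeasure ν]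
    (h : ∀ E, IsElementary E →
      μ {M : Compacts ℝ | (M : Set ℝ) ⊆ E} = ν {M : Compacts ℝ | (M : Set ℝ) ⊆ E})
    (ρ : ℝ) (n : ℕ) : ∫ M, hitPow ρ n M ∂μ = ∫ M, hitPow ρ n M ∂ν := by
  have hm : ∀ S, MeasurableSet {M : Compacts ℝ | (M : Set ℝ) ⊆ allowedSet n S} := fun S =>
    measurableSet_subset_compacts (isElementary_allowedSet n S).finite_frontier
  have key : ∀ κ : Measure (Compacts ℝ), IsFiniteMeasure κ → ∫ M, hitPow ρ n M ∂κ =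
      ∑ S ∈ (dyadicLabels n).powerset,
        labelWeight ρ n S * κ.real {M : Compacts ℝ | (M : Set ℝ) ⊆ allowedSet n S} := by
    intro κ _
    simp_rw [hitPow_eq_sum]
    rw [integral_finsetSum]
    swap
    · exact fun S _ => ((integrable_const (1 : ℝ)).indicator (hm S)).const_mul (labelWeight ρ n S)
    refine Finset.sum_congr rfl fun S _ => ?_
    rw [integral_const_mul, integral_indicator_one (hm S)]
  rw [key μ inferInstance, key ν inferInstance]
  simp only [measureReal_def, h _ (isElementary_allowedSet n _)]

/-- The masses of `{M | M ⊆ E}` determine the integrals of `hitPow`. Letting `n → ∞` and then `ρ →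
1` recovers the mass of the finite sets, without uniqueness of the whole measure. -/
theorem measure_finite_compacts_eq {μ ν : Measure (Compacts ℝ)} [IsFiniteMeasure μ]
    [IsFiniteMeasure ν] (h : ∀ E, IsElementary E →
      μ {M : Compacts ℝ | (M : Set ℝ) ⊆ E} = ν {M : Compacts ℝ | (M : Set ℝ) ⊆ E}) :
    μ {M : Compacts ℝ | (M : Set ℝ).Finite} = ν {M : Compacts ℝ | (M : Set ℝ).Finite} := by
  let ρ : ℕ → ℝ := fun k => 1 - 1 / (k + 1)
  have hρ : ∀ k, 0 ≤ ρ k ∧ ρ k < 1 := fun k => by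
    have : (0 : ℝ) < k + 1 := by positivity
    constructor
    · simp only [ρ, sub_nonneg]
      rw [div_le_one this]
      linarith [k.cast_nonneg (α := ℝ)]
    · simp only [ρ, sub_lt_self_iff]
      positivity
  have hρ1 : Tendsto ρ atTop (𝓝 1) := by
    simpa [ρ] using (tendsto_one_div_add_atTop_nhds_zero_nat (𝕜 := ℝ)).const_sub 1
  have hpow : ∀ k, ∫ M : Compacts ℝ, powCard (ρ k) M ∂μ = ∫ M : Compacts ℝ, powCard (ρ k) M ∂ν :=
    fun k => tendsto_nhds_unique
      ((tendsto_integral_hitPow (hρ k).1 (hρ k).2).congr fun n => integral_hitPow_eq h _ n)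
      (tendsto_integral_hitPow (hρ k).1 (hρ k).2)
  have hlim : ∀ κ : Measure (Compacts ℝ), IsFiniteMeasure κ →
      Tendsto (fun k => ∫ M : Compacts ℝ, powCard (ρ k) M ∂κ) atTop
        (𝓝 (κ.real {M : Compacts ℝ | (M : Set ℝ).Finite})) := by
    intro κ _
    rw [← integral_indicator_one measurableSet_finite_compacts]
    refine tendsto_integral_of_dominated_convergence (fun _ => 1)
      (fun k => (measurable_powCard (hρ k).1 (hρ k).2).aestronglyMeasurable) (integrable_const _)
      (fun k => Eventually.of_forall fun M => ?_) (Eventually.of_forall fun M => ?_)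
    · rw [Real.norm_of_nonneg (powCard_nonneg (hρ k).1 _)]
      exact powCard_le_one (hρ k).1 (hρ k).2.le _
    · by_cases hM : (M : Set ℝ).Finite
      · rw [indicator_of_mem (show M ∈ {M : Compacts ℝ | (M : Set ℝ).Finite} from hM)]
        exact tendsto_powCard_one hM hρ1
      · rw [indicator_of_notMem (show M ∉ {M : Compacts ℝ | (M : Set ℝ).Finite} from hM)]
        simp [powCard, hM]
  have := tendsto_nhds_unique ((hlim μ inferInstance).congr hpow) (hlim ν inferInstance)
  exact (measureReal_eq_measureReal_iff).1 this

theorem measure_infinite_compacts_eq {μ ν : Measure (Compacts ℝ)} [IsFiniteMeasure μ]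
    [IsFiniteMeasure ν] (h : ∀ E, IsElementary E →
      μ {M : Compacts ℝ | (M : Set ℝ) ⊆ E} = ν {M : Compacts ℝ | (M : Set ℝ) ⊆ E}) :
    μ {M : Compacts ℝ | (M : Set ℝ).Infinite} = ν {M : Compacts ℝ | (M : Set ℝ).Infinite} := by
  have hc : {M : Compacts ℝ | (M : Set ℝ).Infinite} =
      {M : Compacts ℝ | (M : Set ℝ).Finite}ᶜ := rfl
  have hu : μ univ = ν univ := by simpa using h univ isElementary_univ
  rw [hc, measure_compl measurableSet_finite_compacts (measure_ne_top _ _),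
    measure_compl measurableSet_finite_compacts (measure_ne_top _ _), hu,
    measure_finite_compacts_eq h]

end Uniqueness

/-! ### The closed subspace of stable vectors. -/

namespace ElementaryProjections

variable {H : Type*} [NormedAddCommGroup H] [InnerProductSpace ℝ H] (Q : ElementaryProjections H)
  {ρ σ : ℝ}

theorem defect_smul (n : ℕ) (c : ℝ) (x : H) :
    Q.defect ρ n (c • x) = c ^ 2 * Q.defect ρ n x := by
  rw [defect, defect, Finset.mul_sum]
  refine Finset.sum_congr rfl fun S _ => ?_
  rw [map_smul, ← smul_sub, norm_smul, mul_pow, Real.norm_eq_abs, sq_abs]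
  ring

theorem defect_add_le (h0 : 0 ≤ ρ) (h1 : ρ ≤ 1) (n : ℕ) (x y : H) :
    Q.defect ρ n (x + y) ≤ 2 * Q.defect ρ n x + 2 * Q.defect ρ n y := by
  rw [defect, defect, defect, Finset.mul_sum, Finset.mul_sum, ← Finset.sum_add_distrib]
  refine Finset.sum_le_sum fun S _ => ?_
  have hw := labelWeight_nonneg h0 h1 n S
  have h2 := parallelogram_law_with_norm ℝ (x - Q.proj (allowedSet n S) x)
    (y - Q.proj (allowedSet n S) y)
  have h3 : ‖x + y - Q.proj (allowedSet n S) (x + y)‖ ^ 2 ≤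
      2 * ‖x - Q.proj (allowedSet n S) x‖ ^ 2 + 2 * ‖y - Q.proj (allowedSet n S) y‖ ^ 2 := by
    rw [map_add, add_sub_add_comm]
    nlinarith [norm_nonneg (x - Q.proj (allowedSet n S) x - (y - Q.proj (allowedSet n S) y))]
  nlinarith [mul_le_mul_of_nonneg_left h3 hw]

/-- Each term is a difference of squared norms. The comparison is made for `|f|` against `f`. -/
theorem defect_le_of_norm_proj_le (h0 : 0 ≤ ρ) (h1 : ρ ≤ 1) (n : ℕ) {x y : H} (hxy : ‖x‖ = ‖y‖)
    (h : ∀ E, IsElementary E → ‖Q.proj E y‖ ≤ ‖Q.proj E x‖) :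
    Q.defect ρ n x ≤ Q.defect ρ n y := by
  refine Finset.sum_le_sum fun S _ => mul_le_mul_of_nonneg_left ?_ (labelWeight_nonneg h0 h1 n S)
  have hE := isElementary_allowedSet n S
  rw [Q.norm_sq_sub_proj hE, Q.norm_sq_sub_proj hE, hxy]
  exact sub_le_sub_left (pow_le_pow_left₀ (norm_nonneg _) (h _ hE) 2) _

theorem defect_le_norm_sq (h0 : 0 ≤ ρ) (h1 : ρ ≤ 1) (n : ℕ) (x : H) :
    Q.defect ρ n x ≤ ‖x‖ ^ 2 := by
  rw [← one_mul (‖x‖ ^ 2), ← sum_labelWeight ρ n, Finset.sum_mul]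
  refine Finset.sum_le_sum fun S _ => mul_le_mul_of_nonneg_left ?_ (labelWeight_nonneg h0 h1 n S)
  rw [Q.norm_sq_sub_proj (isElementary_allowedSet n S)]
  exact sub_le_self _ (sq_nonneg _)

/-- Monotonicity in the parameter lets two stable vectors share one `ρ`. -/
theorem defect_anti (h0 : 0 ≤ ρ) (h : ρ ≤ σ) (n : ℕ) (x : H) :
    Q.defect σ n x ≤ Q.defect ρ n x := by
  obtain ⟨μ, hfin, hμ⟩ := Q.exists_spectralMeasure x
  rw [Q.defect_eq_integral n hμ, Q.defect_eq_integral n hμ]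
  refine integral_mono
    ((HasSymbol.one.sub (Q.hasSymbol_noise σ n)).inner_eq_integral hμ).1
    ((HasSymbol.one.sub (Q.hasSymbol_noise ρ n)).inner_eq_integral hμ).1 fun M => ?_
  exact sub_le_sub_left (pow_le_pow_left₀ h0 h _) 1

variable {Q}

theorem IsStableVector.add {x y : H} (hx : Q.IsStableVector x) (hy : Q.IsStableVector y) :
    Q.IsStableVector (x + y) := by
  intro ε hε
  obtain ⟨ρ, hρ, h⟩ := hx (ε / 4) (by positivity)
  obtain ⟨σ, hσ, h'⟩ := hy (ε / 4) (by positivity)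
  have h0 : 0 ≤ max ρ σ := hρ.1.le.trans (le_max_left _ _)
  have h1 : max ρ σ < 1 := max_lt hρ.2 hσ.2
  refine ⟨max ρ σ, ⟨hρ.1.trans_le (le_max_left _ _), h1⟩, fun n => ?_⟩
  have h2 := Q.defect_add_le h0 h1.le n x y
  have h3 := Q.defect_anti hρ.1.le (le_max_left ρ σ) n x
  have h4 := Q.defect_anti hσ.1.le (le_max_right ρ σ) n y
  linarith [h n, h' n]

theorem IsStableVector.smul (c : ℝ) {x : H} (hx : Q.IsStableVector x) :
    Q.IsStableVector (c • x) := by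
  intro ε hε
  -- The added one avoids division by zero when `c = 0`.
  obtain ⟨ρ, hρ, h⟩ := hx (ε / (c ^ 2 + 1)) (by positivity)
  refine ⟨ρ, hρ, fun n => ?_⟩
  rw [defect_smul]
  have h2 := (le_div_iff₀ (by positivity)).1 (h n)
  have h3 : 0 ≤ Q.defect ρ n x := (sq_nonneg _).trans
    (Q.norm_sq_sub_noise_le_defect hρ.1.le hρ.2.le n x)
  linarith

theorem isStableVector_of_forall_proj_eq {x : H} (h : ∀ E, IsElementary E → Q.proj E x = x) :
    Q.IsStableVector x := fun ε hε => ⟨1 / 2, by norm_num, fun n => by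
  rw [defect, Finset.sum_eq_zero]
  · exact hε.le
  · intro S _
    rw [h _ (isElementary_allowedSet n S), sub_self]
    simp⟩

theorem IsStableVector.of_norm_proj_le {x y : H} (hy : Q.IsStableVector y) (hxy : ‖x‖ = ‖y‖)
    (h : ∀ E, IsElementary E → ‖Q.proj E y‖ ≤ ‖Q.proj E x‖) : Q.IsStableVector x :=
  fun ε hε => (hy ε hε).imp fun _ hρ => ⟨hρ.1, fun n =>
    (Q.defect_le_of_norm_proj_le hρ.1.1.le hρ.1.2.le n hxy h).trans (hρ.2 n)⟩

variable (Q)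

/-- The subspace of stable vectors. -/
def stableSubmodule : Submodule ℝ H where
  carrier := {x | Q.IsStableVector x}
  add_mem' := IsStableVector.add
  zero_mem' := isStableVector_of_forall_proj_eq fun _ _ => map_zero _
  smul_mem' c _ := IsStableVector.smul c

theorem isClosed_stableSubmodule : IsClosed (Q.stableSubmodule : Set H) := by
  refine isClosed_of_closure_subset fun x hx ε hε => ?_
  -- The defect of `x - y` is at most `‖x - y‖ ^ 2 < ε / 4` at every level, and `defect_add_le`
  -- doubles both contributions.
  obtain ⟨y, hy, hxy⟩ := Metric.mem_closure_iff.1 hx (Real.sqrt (ε / 4)) (by positivity)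
  obtain ⟨ρ, hρ, h⟩ := hy (ε / 4) (by positivity)
  refine ⟨ρ, hρ, fun n => ?_⟩
  have h2 := Q.defect_add_le hρ.1.le hρ.2.le n (x - y) y
  rw [sub_add_cancel] at h2
  have h3 := Q.defect_le_norm_sq hρ.1.le hρ.2.le n (x - y)
  rw [dist_eq_norm, Real.lt_sqrt (norm_nonneg _)] at hxy
  linarith [h n]

end ElementaryProjections

/-! ### Closed sublattices of L² and sub-σ-fields. -/

namespace Submodule

variable {Ω : Type*} {m0 : MeasurableSpace Ω} {P : Measure Ω}

/-- The function `g` represents an element of the subspace `V` of `L²`. -/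
def Represents (V : Submodule ℝ (Lp ℝ 2 P)) (g : Ω → ℝ) : Prop :=
  ∃ hg : MemLp g 2 P, hg.toLp g ∈ V

variable {V : Submodule ℝ (Lp ℝ 2 P)} {f g : Ω → ℝ}

theorem represents_coeFn {F : Lp ℝ 2 P} : V.Represents F ↔ F ∈ V :=
  ⟨fun ⟨_, h⟩ => by rwa [Lp.toLp_coeFn] at h, fun h => ⟨Lp.memLp F, by rwa [Lp.toLp_coeFn]⟩⟩

namespace Represents

theorem congr (hf : V.Represents f) (h : f =ᵐ[P] g) : V.Represents g := by
  obtain ⟨h2, hV⟩ := hf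
  refine ⟨h2.ae_eq h, ?_⟩
  rwa [← MemLp.toLp_congr h2 (h2.ae_eq h) h]

theorem add (hf : V.Represents f) (hg : V.Represents g) : V.Represents (f + g) :=
  ⟨hf.1.add hg.1, V.add_mem hf.2 hg.2⟩

theorem const_smul (hf : V.Represents f) (c : ℝ) : V.Represents (c • f) :=
  ⟨hf.1.const_smul c, V.smul_mem c hf.2⟩

theorem sub (hf : V.Represents f) (hg : V.Represents g) : V.Represents (f - g) :=
  ⟨hf.1.sub hg.1, V.sub_mem hf.2 hg.2⟩

theorem posPart (habs : ∀ F ∈ V, |F| ∈ V) (hf : V.Represents f) :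
    V.Represents fun ω => max (f ω) 0 := by
  have h1 : V.Represents fun ω => |f ω| := by
    refine (represents_coeFn.2 (habs _ hf.2)).congr ?_
    filter_upwards [Lp.coeFn_abs (hf.1.toLp f), hf.1.coeFn_toLp] with ω h2 h3
    rw [h2, h3]
  refine ((hf.add h1).const_smul (1 / 2)).congr (Eventually.of_forall fun ω => ?_)
  simp only [Pi.smul_apply, Pi.add_apply, smul_eq_mul]
  rcases le_total 0 (f ω) with h | h
  · rw [abs_of_nonneg h, max_eq_left h]
    ring
  · rw [abs_of_nonpos h, max_eq_right h]
    ring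

theorem max (habs : ∀ F ∈ V, |F| ∈ V) (hf : V.Represents f) (hg : V.Represents g) :
    V.Represents fun ω => max (f ω) (g ω) := by
  refine (hf.add ((hg.sub hf).posPart habs)).congr (Eventually.of_forall fun ω => ?_)
  simp only [Pi.add_apply, Pi.sub_apply]
  rcases le_total (f ω) (g ω) with h | h
  · rw [max_eq_left (sub_nonneg.2 h), max_eq_right h]
    ring
  · rw [max_eq_right (sub_nonpos.2 h), max_eq_left h]
    ring

theorem min (habs : ∀ F ∈ V, |F| ∈ V) (hf : V.Represents f) (hg : V.Represents g) :
    V.Represents fun ω => min (f ω) (g ω) := by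
  refine (hf.sub ((hf.sub hg).posPart habs)).congr (Eventually.of_forall fun ω => ?_)
  simp only [Pi.sub_apply]
  rcases le_total (f ω) (g ω) with h | h
  · rw [max_eq_right (sub_nonpos.2 h), min_eq_left h]
    ring
  · rw [max_eq_left (sub_nonneg.2 h), min_eq_right h]
    ring

theorem of_tendsto [IsProbabilityMeasure P] (hV : IsClosed (V : Set (Lp ℝ 2 P))) {u : ℕ → Ω → ℝ}
    (hu : ∀ n, V.Represents (u n)) (hb : ∀ n ω, |u n ω| ≤ 1)
    (hlim : ∀ ω, Tendsto (fun n => u n ω) atTop (𝓝 (g ω))) : V.Represents g := by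
  have hgm : AEStronglyMeasurable g P :=
    aestronglyMeasurable_of_tendsto_ae atTop (fun n => (hu n).1.1) (Eventually.of_forall hlim)
  have hgb : ∀ ω, |g ω| ≤ 1 := fun ω => le_of_tendsto' (hlim ω).abs fun n => hb n ω
  have hg : MemLp g 2 P := MemLp.of_bound hgm 1 (Eventually.of_forall hgb)
  suffices hlim : Tendsto (fun n => (hu n).1.toLp (u n)) atTop (𝓝 (hg.toLp g)) from
    ⟨hg, hV.mem_of_tendsto hlim (Eventually.of_forall fun n => (hu n).2)⟩
  rw [tendsto_iff_norm_sub_tendsto_zero]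
  have hsq : ∀ n, ‖(hu n).1.toLp (u n) - hg.toLp g‖ ^ 2 = ∫ ω, (u n ω - g ω) ^ 2 ∂P := fun n => by
    rw [← real_inner_self_eq_norm_sq, L2.inner_def, ← MemLp.toLp_sub]
    refine integral_congr_ae ?_
    filter_upwards [((hu n).1.sub hg).coeFn_toLp] with ω h
    rw [h, real_inner_self_eq_norm_sq, Real.norm_eq_abs, sq_abs, Pi.sub_apply]
  have hint : Tendsto (fun n => ∫ ω, (u n ω - g ω) ^ 2 ∂P) atTop (𝓝 (∫ _, (0 : ℝ) ∂P)) := by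
    refine tendsto_integral_of_dominated_convergence (fun _ => 4)
      (fun n => ((hu n).1.1.sub hgm).pow 2) (integrable_const _)
      (fun n => Eventually.of_forall fun ω => ?_) (Eventually.of_forall fun ω => ?_)
    · rw [Real.norm_of_nonneg (sq_nonneg _)]
      have h1 := abs_le.1 (hb n ω)
      have h2 := abs_le.1 (hgb ω)
      nlinarith
    · simpa using ((hlim ω).sub_const (g ω)).pow 2
  rw [integral_zero] at hint
  have h3 := (hint.congr fun n => (hsq n).symm).sqrt
  simpa only [Real.sqrt_sq (norm_nonneg _), Real.sqrt_zero] using h3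

end Represents

variable [IsProbabilityMeasure P]

/-- The σ-field of all sets whose indicators belong to a closed vector sublattice of `L²`
containing the constants. -/
@[reducible]
def sublatticeField (V : Submodule ℝ (Lp ℝ 2 P)) (hV : IsClosed (V : Set (Lp ℝ 2 P)))
    (hone : V.Represents 1) (habs : ∀ F ∈ V, |F| ∈ V) : MeasurableSpace Ω where
  MeasurableSet' A := MeasurableSet[m0] A ∧ V.Represents (A.indicator 1)
  measurableSet_empty := ⟨MeasurableSet.empty,
    (hone.const_smul 0).congr (Eventually.of_forall fun ω => by simp)⟩
  measurableSet_compl A hA := ⟨hA.1.compl, (hone.sub hA.2).congr (Eventually.of_forall fun ω => by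
    by_cases h : ω ∈ A <;> simp [h])⟩
  measurableSet_iUnion A hA := by
    refine ⟨MeasurableSet.iUnion fun i => (hA i).1, ?_⟩
    have hfin : ∀ n, V.Represents ((⋃ i ∈ Finset.range n, A i).indicator 1) := fun n => by
      induction n with
      | zero => exact (hone.const_smul 0).congr (Eventually.of_forall fun ω => by simp)
      | succ n ih =>
        refine (ih.max habs (hA n).2).congr (Eventually.of_forall fun ω => ?_)
        have h : (⋃ i ∈ Finset.range (n + 1), A i) = (⋃ i ∈ Finset.range n, A i) ∪ A n := by
          rw [Finset.range_add_one, Finset.set_biUnion_insert, union_comm]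
        rw [h]
        by_cases h1 : ω ∈ ⋃ i ∈ Finset.range n, A i <;> by_cases h2 : ω ∈ A n <;>
          simp only [indicator, mem_union, h1, h2] <;> simp
    refine Represents.of_tendsto hV hfin (fun n ω => ?_) fun ω => ?_
    · by_cases h : ω ∈ ⋃ i ∈ Finset.range n, A i
      · rw [indicator_of_mem h]; simp
      · rw [indicator_of_notMem h]; simp
    · refine tendsto_const_nhds.congr' ?_
      by_cases h : ω ∈ ⋃ i, A i
      · obtain ⟨i, hi⟩ := mem_iUnion.1 h
        filter_upwards [eventually_gt_atTop i] with n hn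
        rw [indicator_of_mem h, indicator_of_mem]
        exact mem_biUnion (Finset.mem_coe.2 (Finset.mem_range.2 hn)) hi
      · refine Eventually.of_forall fun n => ?_
        show _ = indicator _ _ _
        rw [indicator_of_notMem h, indicator_of_notMem]
        exact fun h' => h (iUnion₂_subset_iUnion _ _ h')

theorem tendsto_min_one_mul_posPart (x : ℝ) :
    Tendsto (fun n : ℕ => min 1 ((n : ℝ) * max x 0)) atTop (𝓝 (if 0 < x then 1 else 0)) := by
  split_ifs with h
  · refine tendsto_const_nhds.congr' ?_
    have h1 : Tendsto (fun n : ℕ => (n : ℝ) * max x 0) atTop atTop :=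
      tendsto_natCast_atTop_atTop.atTop_mul_const (h.trans_le (le_max_left _ _))
    filter_upwards [h1.eventually_ge_atTop 1] with n hn
    rw [min_eq_left hn]
  · simp [max_eq_right (not_lt.1 h)]

/-- A closed vector sublattice of `L²` containing the constants consists of all functions
measurable with respect to a sub-σ-field. -/
theorem exists_mem_iff_aestronglyMeasurable (V : Submodule ℝ (Lp ℝ 2 P))
    (hV : IsClosed (V : Set (Lp ℝ 2 P))) (hone : V.Represents 1) (habs : ∀ F ∈ V, |F| ∈ V) :
    ∃ m ≤ m0, ∀ F : Lp ℝ 2 P, F ∈ V ↔ AEStronglyMeasurable[m] F P := by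
  have hm : V.sublatticeField hV hone habs ≤ m0 := fun A hA => hA.1
  refine ⟨V.sublatticeField hV hone habs, hm, fun F => ⟨fun hF => ?_, ?_⟩⟩
  · have hF' := Lp.aestronglyMeasurable F
    have hrep : V.Represents (hF'.mk F) := (represents_coeFn.2 hF).congr hF'.ae_eq_mk
    refine ⟨hF'.mk F, ?_, hF'.ae_eq_mk⟩
    refine Measurable.stronglyMeasurable ?_
    refine measurable_of_Ioi fun c => ⟨hF'.measurable_mk measurableSet_Ioi, ?_⟩
    -- The indicator of `{F > c}` is the limit of the truncations `min 1 (n * (F - c)⁺)`, which use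
    -- only lattice operations and constants.
    refine Represents.of_tendsto (u := fun n ω => min 1 ((n : ℝ) * max (hF'.mk F ω - c) 0)) hV
      (fun n => ?_) (fun n ω => ?_) fun ω => ?_
    · have h1 : V.Represents (hF'.mk F - c • 1) := hrep.sub (hone.const_smul c)
      refine (hone.min habs ((h1.posPart habs).const_smul n)).congr
        (Eventually.of_forall fun ω => ?_)
      simp
    · have h1 : 0 ≤ (n : ℝ) * max (hF'.mk F ω - c) 0 := by positivity
      rw [abs_of_nonneg (le_min zero_le_one h1)]
      exact min_le_left _ _
    · convert tendsto_min_one_mul_posPart (hF'.mk F ω - c) using 2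
      by_cases h : c < hF'.mk F ω <;> simp [h]
  -- Conversely, indicators of sets of the field lie in `V` by definition, and simple functions are
  -- dense.
  · refine Lp.induction_stronglyMeasurable hm ENNReal.ofNat_ne_top _ (fun c s hs hμs => ?_)
      (fun f g hf hg _ _ _ h1 h2 => V.add_mem h1 h2) ?_ F
    · rw [Lp.simpleFunc.coe_indicatorConst, ← represents_coeFn]
      refine (hs.2.const_smul c).congr ?_
      filter_upwards [indicatorConstLp_coeFn (p := 2) (c := c) (hs := hm s hs) (hμs := hμs.ne)]
        with ω hω
      rw [hω]
      by_cases h : ω ∈ s <;> simp [h]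
    · exact hV.preimage continuous_subtype_val

end Submodule

/-! ### Real and imaginary parts, and conditional expectation as orthogonal projection. -/

section LTwo

variable {Ω : Type*} {m0 : MeasurableSpace Ω} {P : Measure Ω}

theorem ofReal_norm_sq_eq_lintegral (F : Lp ℝ 2 P) :
    ENNReal.ofReal (‖F‖ ^ 2) = ∫⁻ ω, ‖F ω‖ₑ ^ 2 ∂P := by
  have h := eLpNorm_nnreal_pow_eq_lintegral (μ := P) (f := F) (p := 2) two_ne_zero
  rw [ENNReal.ofReal_pow (norm_nonneg _), Lp.norm_def, ENNReal.ofReal_toReal (Lp.eLpNorm_ne_top F)]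
  simpa using h

theorem eLpNorm_sq_eq_lintegral {E : Type*} [NormedAddCommGroup E] (g : Ω → E) :
    eLpNorm g 2 P ^ 2 = ∫⁻ ω, ‖g ω‖ₑ ^ 2 ∂P := by
  have h := eLpNorm_nnreal_pow_eq_lintegral (μ := P) (f := g) (p := 2) two_ne_zero
  simpa using h

theorem enorm_sq_eq_re_add_im {𝕜 : Type*} [RCLike 𝕜] (z : 𝕜) :
    ‖z‖ₑ ^ 2 = ‖RCLike.re z‖ₑ ^ 2 + ‖RCLike.im z‖ₑ ^ 2 := by
  simp only [← ofReal_norm, ← ENNReal.ofReal_pow (norm_nonneg _)]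
  rw [← ENNReal.ofReal_add (sq_nonneg _) (sq_nonneg _), RCLike.norm_sq_eq_def]
  simp [sq]

theorem re_condExp_ae_eq {𝕜 : Type*} [RCLike 𝕜] {m : MeasurableSpace Ω} {f : Ω → 𝕜}
    (hf : Integrable f P) :
    (fun ω => RCLike.re ((P[f | m]) ω)) =ᵐ[P] P[fun ω => RCLike.re (f ω) | m] :=
  (RCLike.reCLM (K := 𝕜)).comp_condExp_comm hf

theorem im_condExp_ae_eq {𝕜 : Type*} [RCLike 𝕜] {m : MeasurableSpace Ω} {f : Ω → 𝕜}
    (hf : Integrable f P) :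
    (fun ω => RCLike.im ((P[f | m]) ω)) =ᵐ[P] P[fun ω => RCLike.im (f ω) | m] :=
  (RCLike.imCLM (K := 𝕜)).comp_condExp_comm hf

theorem condExp_ae_eq_zero_iff_re_im {𝕜 : Type*} [RCLike 𝕜] {m : MeasurableSpace Ω} {f : Ω → 𝕜}
    (hf : Integrable f P) : P[f | m] =ᵐ[P] 0 ↔
      P[fun ω => RCLike.re (f ω) | m] =ᵐ[P] 0 ∧ P[fun ω => RCLike.im (f ω) | m] =ᵐ[P] 0 := by
  constructor
  · intro h
    constructor
    · filter_upwards [h, re_condExp_ae_eq (m := m) hf] with ω h1 h2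
      rw [← h2, h1]
      simp
    · filter_upwards [h, im_condExp_ae_eq (m := m) hf] with ω h1 h2
      rw [← h2, h1]
      simp
  · rintro ⟨hr, hi⟩
    filter_upwards [hr, hi, re_condExp_ae_eq (m := m) hf, im_condExp_ae_eq (m := m) hf]
      with ω h1 h2 h3 h4
    rw [h1] at h3
    rw [h2] at h4
    exact RCLike.ext (by simpa using h3) (by simpa using h4)

theorem aestronglyMeasurable_iff_re_im {𝕜 : Type*} [RCLike 𝕜] {m : MeasurableSpace Ω}
    {f : Ω → 𝕜} : AEStronglyMeasurable[m] f P ↔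
      AEStronglyMeasurable[m] (fun ω => RCLike.re (f ω)) P ∧
        AEStronglyMeasurable[m] (fun ω => RCLike.im (f ω)) P := by
  refine ⟨fun h => ⟨RCLike.continuous_re.comp_aestronglyMeasurable h,
    RCLike.continuous_im.comp_aestronglyMeasurable h⟩, fun ⟨hr, hi⟩ => ?_⟩
  have h := (RCLike.continuous_ofReal (K := 𝕜).comp_aestronglyMeasurable hr).add
    ((RCLike.continuous_ofReal (K := 𝕜).comp_aestronglyMeasurable hi).mul_const RCLike.I)
  refine h.congr (Eventually.of_forall fun ω => ?_)
  exact RCLike.re_add_im (f ω)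

theorem condExp_ae_eq_zero_iff_inner [IsProbabilityMeasure P] {m : MeasurableSpace Ω} (hm : m ≤ m0)
    {g : Ω → ℝ} (hg : MemLp g 2 P) : P[g | m] =ᵐ[P] 0 ↔
      ∀ F : Lp ℝ 2 P, AEStronglyMeasurable[m] F P → inner ℝ F (hg.toLp g) = 0 := by
  have : Fact (m ≤ m0) := ⟨hm⟩
  have h1 : P[g | m] =ᵐ[P] 0 ↔ condExpL2 ℝ ℝ hm (hg.toLp g) = 0 := by
    have h2 := hg.condExpL2_ae_eq_condExp (𝕜 := ℝ) hm
    rw [← Submodule.coe_eq_zero, Lp.eq_zero_iff_ae_eq_zero]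
    exact ⟨fun h => h2.trans h, fun h => h2.symm.trans h⟩
  rw [h1, condExpL2, Submodule.orthogonalProjectionOnto_eq_zero_iff, Submodule.mem_orthogonal]
  simp only [mem_lpMeas_iff_aestronglyMeasurable]

end LTwo

/-! ### The projections of a continuous factorization; stability and sensitivity in L². -/

namespace IsContinuousFactorization

variable {Ω : Type*} {m0 : MeasurableSpace Ω} {P : Measure Ω} {F : ℝ → ℝ → MeasurableSpace Ω}

/-- The conditional expectation given `F_E` as an operator on real `L²`. -/
noncomputable def condExpOn (hF : IsContinuousFactorization P F) (E : Set ℝ) :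
    Lp ℝ 2 P →L[ℝ] Lp ℝ 2 P :=
  (lpMeas ℝ ℝ (fieldOn F E) 2 P).subtypeL.comp (condExpL2 ℝ ℝ (hF.fieldOn_le E))

theorem norm_condExpOn_le (hF : IsContinuousFactorization P F) (E : Set ℝ) (x : Lp ℝ 2 P) :
    ‖hF.condExpOn E x‖ ≤ ‖x‖ :=
  norm_condExpL2_coe_le (𝕜 := ℝ) (hF.fieldOn_le E) x

theorem inner_condExpOn (hF : IsContinuousFactorization P F) (E : Set ℝ) (x y : Lp ℝ 2 P) :
    inner ℝ (hF.condExpOn E x) y = inner ℝ x (hF.condExpOn E y) :=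
  inner_condExpL2_left_eq_right (hF.fieldOn_le E)

variable [IsProbabilityMeasure P] (hF : IsContinuousFactorization P F)

theorem condExpOn_toLp_ae_eq (E : Set ℝ) {g : Ω → ℝ} (hg : MemLp g 2 P) :
    hF.condExpOn E (hg.toLp g) =ᵐ[P] P[g | fieldOn F E] :=
  hg.condExpL2_ae_eq_condExp (𝕜 := ℝ) (hF.fieldOn_le E)

theorem condExpOn_ae_eq (E : Set ℝ) (x : Lp ℝ 2 P) :
    hF.condExpOn E x =ᵐ[P] P[x | fieldOn F E] := by
  simpa using hF.condExpOn_toLp_ae_eq E (Lp.memLp x)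

theorem condExpOn_condExpOn {E E' : Set ℝ} (hE : IsElementary E) (hE' : IsElementary E')
    (x : Lp ℝ 2 P) : hF.condExpOn E (hF.condExpOn E' x) = hF.condExpOn (E ∩ E') x := by
  refine Lp.ext ?_
  exact ((hF.condExpOn_ae_eq E _).trans (condExp_congr_ae (hF.condExpOn_ae_eq E' x))).trans
    ((hF.condExp_condExp_fieldOn hE hE' x).trans (hF.condExpOn_ae_eq _ x).symm)

/-- Almost sure convergence comes from the martingale theorem. Fatou and contractivity give
convergence of norms, and Pythagoras turns this into convergence in L². -/
theorem tendsto_condExpOn_trimmedInterval {D : Set ℝ} (hD : D.Finite) (x : Lp ℝ 2 P) :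
    Tendsto (fun n => hF.condExpOn (trimmedInterval D n) x) atTop (𝓝 x) := by
  have hlim : ∀ᵐ ω ∂P, Tendsto (fun n => hF.condExpOn (trimmedInterval D n) x ω) atTop
      (𝓝 (x ω)) := by
    filter_upwards [hF.tendsto_condExp_trimmedInterval hD ((Lp.memLp x).integrable one_le_two),
      ae_all_iff.2 fun n => hF.condExpOn_ae_eq (trimmedInterval D n) x] with ω h1 h2
    exact h1.congr fun n => (h2 n).symm
  have hfatou := Lp.eLpNorm_lim_le_liminf_eLpNorm (p := 2)
    (fun n => Lp.aestronglyMeasurable (hF.condExpOn (trimmedInterval D n) x)) x hlim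
  have hnorm : Tendsto (fun n => ‖hF.condExpOn (trimmedInterval D n) x‖) atTop (𝓝 ‖x‖) := by
    have h1 : Tendsto (fun n => eLpNorm (hF.condExpOn (trimmedInterval D n) x) 2 P) atTop
        (𝓝 (eLpNorm x 2 P)) := by
      refine tendsto_of_le_liminf_of_limsup_le hfatou ?_
      refine limsup_le_of_le (by isBoundedDefault) (Eventually.of_forall fun n => ?_)
      have h2 := hF.norm_condExpOn_le (trimmedInterval D n) x
      rwa [Lp.norm_def, Lp.norm_def,
        ENNReal.toReal_le_toReal (Lp.eLpNorm_ne_top _) (Lp.eLpNorm_ne_top _)] at h2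
    simp only [Lp.norm_def]
    exact (ENNReal.tendsto_toReal (Lp.eLpNorm_ne_top x)).comp h1
  have hsq : ∀ n, ‖hF.condExpOn (trimmedInterval D n) x - x‖ ^ 2 =
      ‖x‖ ^ 2 - ‖hF.condExpOn (trimmedInterval D n) x‖ ^ 2 := fun n => by
    have hE := isElementary_trimmedInterval hD n
    have h1 : inner ℝ (hF.condExpOn (trimmedInterval D n) x) x =
        ‖hF.condExpOn (trimmedInterval D n) x‖ ^ 2 := by
      rw [← real_inner_self_eq_norm_sq, hF.inner_condExpOn, hF.inner_condExpOn,
        hF.condExpOn_condExpOn hE hE, inter_self]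
    rw [norm_sub_sq_real, h1]
    ring
  rw [tendsto_iff_norm_sub_tendsto_zero]
  have h1 := (hnorm.pow 2).const_sub (‖x‖ ^ 2)
  have h2 := (h1.congr fun n => (hsq n).symm).sqrt
  simpa only [Real.sqrt_sq (norm_nonneg _), sub_self, Real.sqrt_zero] using h2

/-- The projections of real `L²` given by a continuous factorization. -/
noncomputable def projections : ElementaryProjections (Lp ℝ 2 P) where
  proj := hF.condExpOn
  inner_proj := hF.inner_condExpOn
  proj_proj _ _ hE hE' := hF.condExpOn_condExpOn hE hE'
  proj_univ x := Lp.ext ((hF.condExpOn_ae_eq univ x).trans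
    (hF.condExp_fieldOn_univ ((Lp.memLp x).integrable one_le_two)))
  tendsto _ hD := hF.tendsto_condExpOn_trimmedInterval hD

theorem condExpOn_const (E : Set ℝ) (c : ℝ) :
    hF.condExpOn E ((memLp_const (μ := P) (p := 2) c).toLp _) = (memLp_const c).toLp _ := by
  refine Lp.ext ((hF.condExpOn_toLp_ae_eq E (memLp_const c)).trans ?_)
  rw [condExp_const (hF.fieldOn_le E)]
  exact (memLp_const c).coeFn_toLp.symm

/-- Here positivity of conditional expectation enters, beyond the Hilbert space structure; it makes
the stable subspace a lattice. -/
theorem norm_condExpOn_le_norm_condExpOn_abs (E : Set ℝ) (x : Lp ℝ 2 P) :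
    ‖hF.condExpOn E x‖ ≤ ‖hF.condExpOn E |x|‖ := by
  refine Lp.norm_le_norm_of_ae_le ?_
  have h : P[(|x| : Lp ℝ 2 P) | fieldOn F E] =ᵐ[P] P[abs (x : Ω → ℝ) | fieldOn F E] :=
    condExp_congr_ae (Lp.coeFn_abs x)
  filter_upwards [hF.condExpOn_ae_eq E x, hF.condExpOn_ae_eq E |x|, h,
    abs_condExp_ae_le_condExp_abs (m := fieldOn F E) (μ := P) (x : Ω → ℝ)] with ω h1 h2 h3 h4
  rw [h1, h2, h3, Real.norm_eq_abs, Real.norm_eq_abs]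
  exact h4.trans (le_abs_self _)

theorem exists_isStableVector_iff_aestronglyMeasurable : ∃ m ≤ m0, ∀ x : Lp ℝ 2 P,
    hF.projections.IsStableVector x ↔ AEStronglyMeasurable[m] x P := by
  refine hF.projections.stableSubmodule.exists_mem_iff_aestronglyMeasurable
    hF.projections.isClosed_stableSubmodule
    ⟨memLp_const 1, ElementaryProjections.isStableVector_of_forall_proj_eq fun E _ =>
      hF.condExpOn_const E 1⟩ fun x hx => ?_
  exact ElementaryProjections.IsStableVector.of_norm_proj_le hx (norm_abs_eq_norm x)
    fun E _ => hF.norm_condExpOn_le_norm_condExpOn_abs E x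

variable {𝕜 : Type*} [RCLike 𝕜] {f : Ω → 𝕜}

theorem eLpNorm_condExp_fieldOn_sq (hf : MemLp f 2 P) (E : Set ℝ) :
    eLpNorm (P[f | fieldOn F E]) 2 P ^ 2 =
      ENNReal.ofReal (‖hF.condExpOn E (hf.re.toLp _)‖ ^ 2) +
        ENNReal.ofReal (‖hF.condExpOn E (hf.im.toLp _)‖ ^ 2) := by
  have hi := hf.integrable one_le_two
  rw [eLpNorm_sq_eq_lintegral, ofReal_norm_sq_eq_lintegral, ofReal_norm_sq_eq_lintegral,
    ← lintegral_add_left' ((Lp.aestronglyMeasurable _).enorm.pow_const 2)]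
  refine lintegral_congr_ae ?_
  filter_upwards [re_condExp_ae_eq (m := fieldOn F E) hi, im_condExp_ae_eq (m := fieldOn F E) hi,
    hF.condExpOn_toLp_ae_eq E hf.re, hF.condExpOn_toLp_ae_eq E hf.im] with ω h1 h2 h3 h4
  rw [enorm_sq_eq_re_add_im, h1, h2, h3, h4]

theorem isSpectralMeasure_add (hf : MemLp f 2 P) {μ ν : Measure (Compacts ℝ)} [IsFiniteMeasure μ]
    [IsFiniteMeasure ν] (hμ : hF.projections.IsSpectral (hf.re.toLp _) μ)
    (hν : hF.projections.IsSpectral (hf.im.toLp _) ν) : IsSpectralMeasure P F f (μ + ν) where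
  finite := inferInstance
  apply_subset E hE := by
    rw [hF.eLpNorm_condExp_fieldOn_sq hf, Measure.add_apply, hμ E hE, hν E hE]
    rfl

/-- The spectral measures of the real and imaginary parts add up to one for `f`. Any other spectral
measure of `f` gives the infinite sets the same mass, so the existential in the definition is
harmless. -/
theorem isStableRV_iff (hf : MemLp f 2 P) : IsStableRV P F f ↔
    hF.projections.IsStableVector (hf.re.toLp _) ∧
      hF.projections.IsStableVector (hf.im.toLp _) := by
  obtain ⟨μ, hμf, hμ⟩ := hF.projections.exists_spectralMeasure (hf.re.toLp _)
  obtain ⟨ν, hνf, hν⟩ := hF.projections.exists_spectralMeasure (hf.im.toLp _)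
  have hs := hF.isSpectralMeasure_add hf hμ hν
  rw [hF.projections.isStableVector_iff hμ, hF.projections.isStableVector_iff hν, ← add_eq_zero,
    ← Measure.add_apply]
  refine ⟨fun ⟨κ, hκ, h0⟩ => ?_, fun h => ⟨_, hs, h⟩⟩
  have := hκ.finite
  rw [← h0]
  exact measure_infinite_compacts_eq fun E hE =>
    (hs.apply_subset E hE).trans (hκ.apply_subset E hE).symm

theorem isSensitiveRV_iff (hf : MemLp f 2 P) : IsSensitiveRV P F f ↔
    (∀ y, hF.projections.IsStableVector y → inner ℝ y (hf.re.toLp _) = 0) ∧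
      ∀ y, hF.projections.IsStableVector y → inner ℝ y (hf.im.toLp _) = 0 := by
  obtain ⟨μ, hμf, hμ⟩ := hF.projections.exists_spectralMeasure (hf.re.toLp _)
  obtain ⟨ν, hνf, hν⟩ := hF.projections.exists_spectralMeasure (hf.im.toLp _)
  have hs := hF.isSpectralMeasure_add hf hμ hν
  rw [hF.projections.forall_isStableVector_inner_eq_zero_iff hμ,
    hF.projections.forall_isStableVector_inner_eq_zero_iff hν, ← add_eq_zero, ← Measure.add_apply]
  refine ⟨fun ⟨κ, hκ, h0⟩ => ?_, fun h => ⟨_, hs, h⟩⟩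
  have := hκ.finite
  rw [← h0]
  exact measure_finite_compacts_eq fun E hE =>
    (hs.apply_subset E hE).trans (hκ.apply_subset E hE).symm

end IsContinuousFactorization

theorem theorem5p9 {Ω : Type*} {m0 : MeasurableSpace Ω} (P : Measure Ω) [IsProbabilityMeasure P]
    (F : ℝ → ℝ → MeasurableSpace Ω) (hF : IsContinuousFactorization P F) :
    ∃ Fstable : MeasurableSpace Ω, Fstable ≤ m0 ∧
      ∀ (𝕜 : Type*) [RCLike 𝕜] (f : Ω → 𝕜), MemLp f 2 P →
        (IsStableRV P F f ↔ AEStronglyMeasurable[Fstable] f P) ∧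
        (IsSensitiveRV P F f ↔ P[f | Fstable] =ᵐ[P] 0) := by
  -- The σ-field comes from real L² alone, so the same one serves every `𝕜`.
  obtain ⟨m, hm, h⟩ := hF.exists_isStableVector_iff_aestronglyMeasurable
  refine ⟨m, hm, fun 𝕜 _ f hf => ⟨?_, ?_⟩⟩
  · rw [hF.isStableRV_iff hf, aestronglyMeasurable_iff_re_im, h, h]
    exact and_congr (aestronglyMeasurable_congr hf.re.coeFn_toLp)
      (aestronglyMeasurable_congr hf.im.coeFn_toLp)
  · rw [hF.isSensitiveRV_iff hf, condExp_ae_eq_zero_iff_re_im (hf.integrable one_le_two),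
      condExp_ae_eq_zero_iff_inner hm hf.re, condExp_ae_eq_zero_iff_inner hm hf.im]
    simp only [h]
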